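/- Let $\mathfrak h$ be a finite-dimensional complex vector space and let $W\subset GL(\mathfrak h)$ be a finite group generated by the set $\mathcal R$ of its pseudo-reflections (the elements of $W$ whose fixed space in $\mathfrak h$ is a hyperplane). For $s\in\mathcal R$ let $\alpha_s\in\mathfrak h^*$ be nonzero and vanish on the hyperplane of $\mathfrak h$ fixed by $s$, and let $\alpha_s^\vee\in\mathfrak h$ be nonzero and be annihilated by the hyperplane of $\mathfrak h^*$ fixed by $s$. Let $t\in\mathbb C$ and let $c:\mathcal R\to\mathbb C$ be invariant under conjugation by $W$. Put $V=\mathfrak h\oplus\mathfrak h^*$. The rational Cherednik algebra $\mathbf H=\mathbf H_{t,c}$ is the quotient of $T(V)\rtimes\mathbb C[W]$ by the relations $[x,x']=0$, $[y,y']=0$ and $$[y,x]=t\langle y,x\rangle-\sum_{s\in\mathcal R}c(s)\frac{\langle y,\alpha_s\rangle\langle\alpha_s^\vee,x\rangle}{\langle\alpha_s^\vee,\alpha_s\rangle}\,s\qquad(x,x'\in\mathfrak h^*,\ y,y'\in\mathfrak h).$$ Let $C(V)$ be the Clifford algebra of $V$, with relations $xx'+x'x=yy'+y'y=0$ and $xy+yx=-2\langle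 x,y\rangle$. Let $p:\widetilde W\to W$ be the pull-back along $W\subset O(V)$ of the Pin cover $\mathrm{Pin}(V)\to O(V)$, so that $\widetilde W$ maps into $C(V)^\times$, and let $\Delta:\mathbb C[\widetilde W]\to\mathbf H\otimes C(V)$ be the linear extension of $\widetilde w\mapsto p(\widetilde w)\otimes\widetilde w$. Let $\mathbb C^*$ act on $\mathbf H$ and on $C(V)$ by algebra automorphisms with $\lambda\cdot x=\lambda^{-1}x$, $\lambda\cdot y=\lambda y$ for $x\in\mathfrak h^*$, $y\in\mathfrak h$, and $\lambda\cdot w=w$ for $w\in W$. Let $\mathbf A=(\mathbf H\otimes C(V))^{\mathbb C^*}$ be the invariants of the diagonal action, and let $\mathbf A^{\widetilde W}$ be the subalgebra of those elements of $\mathbf A$ that are invariant under conjugation by all $\Delta(\widetilde w)$, $\widetilde w\in\widetilde W$. For a basis $y_1,\dots,y_n$ of $\mathfrak h$ with dual basis $x_1,\dots,x_n$ of $\mathfrak h^*$ put $$D_x=\sum_i x_i\otimes y_i,\qquad D_y=\sum_i y_i\otimes x_i\quad\text{in }\mathbf H\otimes C(V).$$ Let $\epsilon$ be the automorphism of $\mathbf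 H\otimes C(V)$ that is $1$ on $\mathbf H\otimes C^{even}(V)$ and $-1$ on $\mathbf H\otimes C^{odd}(V)$. Theorem. The formulas $\delta_d(a)=D_xa-\epsilon(a)D_x$ and $\delta_\partial(a)=D_ya-\epsilon(a)D_y$ define maps $\delta_d,\delta_\partial:\mathbf A^{\widetilde W}\to\mathbf A^{\widetilde W}$, and $$\ker\delta_d=\mathrm{im}\,\delta_d\oplus\Delta\bigl(\mathbb C[\widetilde W]^{\widetilde W}\bigr),\qquad \ker\delta_\partial=\mathrm{im}\,\delta_\partial\oplus\Delta\bigl(\mathbb C[\widetilde W]^{\widetilde W}\bigr),$$ where $\mathbb C[\widetilde W]^{\widetilde W}$ denotes the invariants of the group algebra under conjugation by $\widetilde W$. -/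

import Mathlib

open scoped TensorProduct

noncomputable section

namespace HalfDirac

variable {h : Type*} [AddCommGroup h] [Module ℂ h]

/-- The pseudo-reflections of `W`: the elements whose space of fixed vectors is a hyperplane. -/
def pseudoReflections (W : Subgroup (h ≃ₗ[ℂ] h)) : Set W :=
  {s | Module.finrank ℂ (LinearMap.eqLocus ((s : h ≃ₗ[ℂ] h) : h →ₗ[ℂ] h) LinearMap.id) + 1 =
    Module.finrank ℂ h}

/-- The action of a group element on the dual space: `f ↦ f ∘ w⁻¹`. -/
def dualAct (w : h ≃ₗ[ℂ] h) (f : Module.Dual ℂ h) : Module.Dual ℂ h :=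
  f ∘ₗ ((w⁻¹ : h ≃ₗ[ℂ] h) : h →ₗ[ℂ] h)

/-- A choice, for every pseudo-reflection `s` of `W`, of a nonzero `root s` in the dual of `h`
vanishing on the hyperplane of `h` fixed by `s`, and of a nonzero `coroot s` in `h` annihilated by
the hyperplane of the dual of `h` fixed by `s`. Both are determined up to a nonzero scalar. -/
structure RootChoice (W : Subgroup (h ≃ₗ[ℂ] h)) where
  root : W → Module.Dual ℂ h
  coroot : W → h
  root_ne_zero : ∀ s ∈ pseudoReflections W, root s ≠ 0
  root_apply_eq_zero : ∀ s ∈ pseudoReflections W, ∀ y : h, s.1 y = y → root s y = 0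
  coroot_ne_zero : ∀ s ∈ pseudoReflections W, coroot s ≠ 0
  apply_coroot_eq_zero : ∀ s ∈ pseudoReflections W, ∀ f : Module.Dual ℂ h,
    dualAct s.1 f = f → f (coroot s) = 0

variable {W : Subgroup (h ≃ₗ[ℂ] h)}

/-! ### The rational Cherednik algebra -/

/-- Generators of the rational Cherednik algebra: linear forms on `h`, vectors of `h`, and
group elements. -/
inductive Gen (W : Subgroup (h ≃ₗ[ℂ] h))
  | x (f : Module.Dual ℂ h) : Gen W
  | y (v : h) : Gen W
  | g (w : W) : Gen W

/-- The free generators, as elements of the free algebra. -/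
def gen (a : Gen W) : FreeAlgebra ℂ (Gen W) := FreeAlgebra.ι ℂ a

/-- The defining relations of the rational Cherednik algebra: those of
`T(h ⊕ h*) ⋊ ℂ[W]` (linearity, multiplication in `W`, `w v w⁻¹ = w(v)`), commutativity of the
linear forms among themselves and of the vectors among themselves, and
`[y, x] = t⟨y, x⟩ - ∑ₛ c(s) ⟨y, αₛ⟩⟨αₛ^∨, x⟩ / ⟨αₛ^∨, αₛ⟩ s`. -/
inductive Rel (α : RootChoice W) (t : ℂ) (c : W → ℂ) :
    FreeAlgebra ℂ (Gen W) → FreeAlgebra ℂ (Gen W) → Prop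
  | x_add (f f' : Module.Dual ℂ h) : Rel α t c (gen (.x (f + f'))) (gen (.x f) + gen (.x f'))
  | x_smul (r : ℂ) (f : Module.Dual ℂ h) : Rel α t c (gen (.x (r • f))) (r • gen (.x f))
  | y_add (v v' : h) : Rel α t c (gen (.y (v + v'))) (gen (.y v) + gen (.y v'))
  | y_smul (r : ℂ) (v : h) : Rel α t c (gen (.y (r • v))) (r • gen (.y v))
  | g_one : Rel α t c (gen (.g 1)) 1
  | g_mul (w w' : W) : Rel α t c (gen (.g (w * w'))) (gen (.g w) * gen (.g w'))
  | g_x (w : W) (f : Module.Dual ℂ h) :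
      Rel α t c (gen (.g w) * gen (.x f)) (gen (.x (dualAct w.1 f)) * gen (.g w))
  | g_y (w : W) (v : h) :
      Rel α t c (gen (.g w) * gen (.y v)) (gen (.y (w.1 v)) * gen (.g w))
  | x_comm (f f' : Module.Dual ℂ h) :
      Rel α t c (gen (.x f) * gen (.x f')) (gen (.x f') * gen (.x f))
  | y_comm (v v' : h) :
      Rel α t c (gen (.y v) * gen (.y v')) (gen (.y v') * gen (.y v))
  | y_x (v : h) (f : Module.Dual ℂ h) :
      Rel α t c (gen (.y v) * gen (.x f) - gen (.x f) * gen (.y v))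
        (algebraMap ℂ _ (t * f v) - ∑ᶠ s ∈ pseudoReflections W,
          (c s * (α.root s v * f (α.coroot s) / α.root s (α.coroot s))) • gen (.g s))

/-- The rational Cherednik algebra attached to `W` acting on `h`, with parameters `t` and `c`. -/
def Cherednik (α : RootChoice W) (t : ℂ) (c : W → ℂ) : Type _ := RingQuot (Rel α t c)

section

variable (α : RootChoice W) (t : ℂ) (c : W → ℂ)

instance : Ring (Cherednik α t c) := inferInstanceAs (Ring (RingQuot (Rel α t c)))

instance : Algebra ℂ (Cherednik α t c) := inferInstanceAs (Algebra ℂ (RingQuot (Rel α t c)))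

/-- The quotient map from the free algebra. -/
def Cherednik.mk : FreeAlgebra ℂ (Gen W) →ₐ[ℂ] Cherednik α t c :=
  RingQuot.mkAlgHom ℂ (Rel α t c)

variable {α t c} in
theorem Cherednik.mk_eq {a b : FreeAlgebra ℂ (Gen W)} (hab : Rel α t c a b) :
    Cherednik.mk α t c a = Cherednik.mk α t c b :=
  RingQuot.mkAlgHom_rel ℂ hab

/-- The image of a linear form `f` on `h` in the Cherednik algebra. -/
def Cherednik.x (f : Module.Dual ℂ h) : Cherednik α t c := Cherednik.mk α t c (gen (.x f))

/-- The image of a vector `v` of `h` in the Cherednik algebra. -/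
def Cherednik.y (v : h) : Cherednik α t c := Cherednik.mk α t c (gen (.y v))

/-- The image of the group `W` in the Cherednik algebra. -/
def Cherednik.ofGroup : W →* Cherednik α t c where
  toFun w := Cherednik.mk α t c (gen (.g w))
  map_one' := by rw [Cherednik.mk_eq .g_one, map_one]
  map_mul' w w' := by rw [Cherednik.mk_eq (.g_mul w w'), map_mul]

/-- Images of the generators under the action of `z ∈ ℂˣ`. -/
def Cherednik.cstarGen (z : ℂˣ) : Gen W → Cherednik α t c
  | .x f => (↑z⁻¹ : ℂ) • Cherednik.x α t c f
  | .y v => (z : ℂ) • Cherednik.y α t c v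
  | .g w => Cherednik.ofGroup α t c w

theorem Cherednik.cstarGen_rel (z : ℂˣ) {a b : FreeAlgebra ℂ (Gen W)} (hab : Rel α t c a b) :
    FreeAlgebra.lift ℂ (Cherednik.cstarGen α t c z) a =
      FreeAlgebra.lift ℂ (Cherednik.cstarGen α t c z) b := by
  have key : ∀ a : Gen W, FreeAlgebra.lift ℂ (Cherednik.cstarGen α t c z) (gen a) =
      Cherednik.cstarGen α t c z a := fun a => FreeAlgebra.lift_ι_apply _ _
  have hz : (z : ℂ) * (↑z⁻¹ : ℂ) = 1 := by simp
  induction hab with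
  | x_add f f' =>
    simp only [map_add, key, cstarGen, Cherednik.x]
    rw [mk_eq (.x_add f f'), map_add, smul_add]
  | x_smul r f =>
    simp only [map_smul, key, cstarGen, Cherednik.x]
    rw [mk_eq (.x_smul r f), map_smul, smul_comm]
  | y_add v v' =>
    simp only [map_add, key, cstarGen, Cherednik.y]
    rw [mk_eq (.y_add v v'), map_add, smul_add]
  | y_smul r v =>
    simp only [map_smul, key, cstarGen, Cherednik.y]
    rw [mk_eq (.y_smul r v), map_smul, smul_comm]
  | g_one => simp only [map_one, key, cstarGen]
  | g_mul w w' => simp only [map_mul, key, cstarGen]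
  | g_x w f =>
    have e := mk_eq (Rel.g_x (α := α) (t := t) (c := c) w f)
    rw [map_mul, map_mul] at e
    simp only [map_mul, key, cstarGen, Cherednik.x, ofGroup, MonoidHom.coe_mk, OneHom.coe_mk,
      mul_smul_comm, smul_mul_assoc, e]
  | g_y w v =>
    have e := mk_eq (Rel.g_y (α := α) (t := t) (c := c) w v)
    rw [map_mul, map_mul] at e
    simp only [map_mul, key, cstarGen, Cherednik.y, ofGroup, MonoidHom.coe_mk, OneHom.coe_mk,
      mul_smul_comm, smul_mul_assoc, e]
  | x_comm f f' =>
    have e := mk_eq (Rel.x_comm (α := α) (t := t) (c := c) f f')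
    rw [map_mul, map_mul] at e
    simp only [map_mul, key, cstarGen, Cherednik.x, mul_smul_comm, smul_mul_assoc, e]
  | y_comm v v' =>
    have e := mk_eq (Rel.y_comm (α := α) (t := t) (c := c) v v')
    rw [map_mul, map_mul] at e
    simp only [map_mul, key, cstarGen, Cherednik.y, mul_smul_comm, smul_mul_assoc, e]
  | y_x v f =>
    have hfix : ∀ r : FreeAlgebra ℂ (Gen W), r ∈ Algebra.adjoin ℂ (Set.range fun w => gen (.g w)) →
        FreeAlgebra.lift ℂ (cstarGen α t c z) r = mk α t c r := by
      intro r hr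
      induction hr using Algebra.adjoin_induction with
      | mem r hr => obtain ⟨w, rfl⟩ := hr; rw [key]; rfl
      | algebraMap r => rw [AlgHom.commutes, AlgHom.commutes]
      | add r s _ _ hr hs => rw [map_add, map_add, hr, hs]
      | mul r s _ _ hr hs => rw [map_mul, map_mul, hr, hs]
    refine Eq.trans ?_ (hfix _ ?_).symm
    · rw [← mk_eq (Rel.y_x v f)]
      simp only [map_sub, map_mul, key, cstarGen, Cherednik.x, Cherednik.y, mul_smul_comm,
        smul_mul_assoc, smul_smul]
      rw [hz, mul_comm, hz, one_smul, one_smul]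
    · refine sub_mem (algebraMap_mem _ _) (finsum_mem_induction (· ∈ Algebra.adjoin ℂ _)
        (zero_mem _) (fun _ _ => add_mem) fun s _ => ?_)
      exact Subalgebra.smul_mem _ (Algebra.subset_adjoin (Set.mem_range_self s)) _

/-- The action of `ℂˣ` on the Cherednik algebra by algebra automorphisms:
`z • x = z⁻¹ x`, `z • y = z y`, `z • w = w`. -/
def Cherednik.cstar (z : ℂˣ) : Cherednik α t c →ₐ[ℂ] Cherednik α t c :=
  RingQuot.liftAlgHom ℂ ⟨FreeAlgebra.lift ℂ (Cherednik.cstarGen α t c z),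
    fun _ _ hab => Cherednik.cstarGen_rel α t c z hab⟩

end

/-! ### The Clifford algebra of `V = h* ⊕ h` and the double cover of `W` -/

variable (h) in
/-- The quadratic form `v ↦ -⟨v, v⟩` on `V = h* ⊕ h`, where `⟨x, x'⟩ = ⟨y, y'⟩ = 0` and
`⟨x, y⟩ = x(y)`. In its Clifford algebra `x y + y x = -2 x(y)`. -/
def cliffordForm : QuadraticForm ℂ (Module.Dual ℂ h × h) :=
  (-2 : ℂ) • QuadraticForm.dualProd ℂ h

variable (h) in
/-- The Clifford algebra `C(V)`. -/
abbrev Cliff : Type _ := CliffordAlgebra (cliffordForm h)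

/-- The inclusion of `h*` in the Clifford algebra. -/
def cliffX (f : Module.Dual ℂ h) : Cliff h := CliffordAlgebra.ι (cliffordForm h) (f, 0)

/-- The inclusion of `h` in the Clifford algebra. -/
def cliffY (v : h) : Cliff h := CliffordAlgebra.ι (cliffordForm h) (0, v)

/-- The isometry `(f, v) ↦ (z⁻¹ f, z v)` of `V`. -/
def cstarIsometry (z : ℂˣ) : cliffordForm h →qᵢ cliffordForm h where
  toFun p := ((↑z⁻¹ : ℂ) • p.1, (z : ℂ) • p.2)
  map_add' p q := by simp
  map_smul' r p := by simp [smul_comm r]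
  map_app' p := by simp [cliffordForm]

/-- The action of `ℂˣ` on the Clifford algebra: `z • x = z⁻¹ x`, `z • y = z y`. -/
def cliffCstar (z : ℂˣ) : Cliff h →ₐ[ℂ] Cliff h := CliffordAlgebra.map (cstarIsometry z)

/-- The action of `GL(h)` on `V = h* ⊕ h`. -/
def actV (w : h ≃ₗ[ℂ] h) (p : Module.Dual ℂ h × h) : Module.Dual ℂ h × h :=
  (dualAct w p.1, w p.2)

theorem actV_mul (w w' : h ≃ₗ[ℂ] h) (p : Module.Dual ℂ h × h) :
    actV (w * w') p = actV w (actV w' p) := by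
  refine Prod.ext ?_ rfl
  ext v
  simp [actV, dualAct, mul_inv_rev]

variable (W) in
/-- The double cover of `W`: the pull-back along `W ⊂ O(V)` of the Pin cover `Pin(V) → O(V)`,
which sends `u` to the orthogonal map `v ↦ ε(u) v u⁻¹` (with `ε` the parity automorphism). -/
def pinCover : Subgroup (pinGroup (cliffordForm h) × W) where
  carrier := {q | ∀ v : Module.Dual ℂ h × h,
    CliffordAlgebra.involute (q.1 : Cliff h) * CliffordAlgebra.ι (cliffordForm h) v *
      ((q.1⁻¹ : pinGroup (cliffordForm h)) : Cliff h) =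
        CliffordAlgebra.ι (cliffordForm h) (actV q.2.1 v)}
  one_mem' := by
    intro v
    have : actV (1 : h ≃ₗ[ℂ] h) v = v := Prod.ext (by ext; simp [actV, dualAct]) rfl
    simp [this]
  mul_mem' := by
    intro q q' hq hq' v
    have : ((q * q').2 : W).1 = q.2.1 * q'.2.1 := rfl
    rw [this, actV_mul, ← hq, ← hq']
    simp [mul_assoc]
  inv_mem' := by
    intro q hq v
    have e := hq (actV (q⁻¹).2.1 v)
    have h1 : actV q.2.1 (actV (q⁻¹).2.1 v) = v := by
      rw [← actV_mul]
      have : q.2.1 * (q⁻¹).2.1 = 1 := by simp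
      rw [this]
      exact Prod.ext (by ext; simp [actV, dualAct]) rfl
    have h2 : ((q.1⁻¹ : pinGroup (cliffordForm h)) : Cliff h) * (q.1 : Cliff h) = 1 := by
      rw [← Submonoid.coe_mul, inv_mul_cancel, Submonoid.coe_one]
    have h3 : CliffordAlgebra.involute ((q.1⁻¹ : pinGroup (cliffordForm h)) : Cliff h) *
        CliffordAlgebra.involute (q.1 : Cliff h) = 1 := by rw [← map_mul, h2, map_one]
    rw [h1] at e
    rw [← e, Prod.fst_inv, inv_inv]
    simp only [mul_assoc]
    rw [h2, mul_one, ← mul_assoc, h3, one_mul]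

/-! ### The algebra `H ⊗ C(V)` and its elements -/

section

variable (α : RootChoice W) (t : ℂ) (c : W → ℂ)

/-- The (ungraded) tensor product algebra `H ⊗ C(V)`. -/
abbrev HC : Type _ := Cherednik α t c ⊗[ℂ] Cliff h

/-- The diagonal map on the double cover: `w̃ ↦ p(w̃) ⊗ w̃`. -/
def diagGroup : pinCover W →* HC α t c where
  toFun q := Cherednik.ofGroup α t c q.1.2 ⊗ₜ[ℂ] (q.1.1 : Cliff h)
  map_one' := by simp [Algebra.TensorProduct.one_def]
  map_mul' q q' := by simp

/-- The linear extension `Δ : ℂ[W̃] → H ⊗ C(V)` of the diagonal map. -/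
def diag : MonoidAlgebra ℂ (pinCover W) →ₐ[ℂ] HC α t c :=
  MonoidAlgebra.lift ℂ (HC α t c) (pinCover W) (diagGroup α t c)

/-- The parity automorphism `ε` of `H ⊗ C(V)`: the identity on `H ⊗ C^even(V)` and minus the
identity on `H ⊗ C^odd(V)`. -/
def parity : HC α t c →ₐ[ℂ] HC α t c :=
  Algebra.TensorProduct.map (AlgHom.id ℂ (Cherednik α t c)) CliffordAlgebra.involute

/-- The diagonal action of `ℂˣ` on `H ⊗ C(V)`. -/
def cstar (z : ℂˣ) : HC α t c →ₐ[ℂ] HC α t c :=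
  Algebra.TensorProduct.map (Cherednik.cstar α t c z) (cliffCstar z)

/-- The algebra `A = (H ⊗ C(V))^{ℂˣ}`. -/
def algA : Subalgebra ℂ (HC α t c) :=
  ⨅ z : ℂˣ, AlgHom.equalizer (cstar α t c z) (AlgHom.id ℂ (HC α t c))

/-- The algebra `A^{W̃}` of elements of `A` invariant under conjugation by `Δ(w̃)`, `w̃ ∈ W̃`. -/
def algAInv : Subalgebra ℂ (HC α t c) where
  carrier := {a | a ∈ algA α t c ∧
    ∀ q : pinCover W, diagGroup α t c q * a * diagGroup α t c q⁻¹ = a}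
  mul_mem' := by
    rintro a b ⟨ha, ha'⟩ ⟨hb, hb'⟩
    refine ⟨mul_mem ha hb, fun q => ?_⟩
    have e : diagGroup α t c q⁻¹ * diagGroup α t c q = 1 := by
      rw [← map_mul, inv_mul_cancel, map_one]
    calc diagGroup α t c q * (a * b) * diagGroup α t c q⁻¹
        = (diagGroup α t c q * a * 1) * b * diagGroup α t c q⁻¹ := by simp only [mul_one, mul_assoc]
      _ = (diagGroup α t c q * a * diagGroup α t c q⁻¹) *
          (diagGroup α t c q * b * diagGroup α t c q⁻¹) := by rw [← e]; simp only [mul_assoc]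
      _ = a * b := by rw [ha', hb']
  add_mem' := by
    rintro a b ⟨ha, ha'⟩ ⟨hb, hb'⟩
    exact ⟨add_mem ha hb, fun q => by rw [mul_add, add_mul, ha', hb']⟩
  algebraMap_mem' r := by
    refine ⟨algebraMap_mem _ r, fun q => ?_⟩
    rw [← Algebra.commutes, mul_assoc, ← map_mul, mul_inv_cancel, map_one, mul_one]

variable (W) in
/-- The conjugation invariants `ℂ[W̃]^{W̃}` of the group algebra of `W̃`. -/
def groupAlgInv : Submodule ℂ (MonoidAlgebra ℂ (pinCover W)) where
  carrier := {a | ∀ q : pinCover W,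
    MonoidAlgebra.of ℂ (pinCover W) q * a * MonoidAlgebra.of ℂ (pinCover W) q⁻¹ = a}
  zero_mem' q := by simp
  add_mem' {a b} ha hb q := by rw [mul_add, add_mul, ha, hb]
  smul_mem' r a ha q := by rw [mul_smul_comm, smul_mul_assoc, ha]

/-- The subspace `Δ(ℂ[W̃]^{W̃})` of `H ⊗ C(V)`. -/
def diagInv : Submodule ℂ (HC α t c) := (groupAlgInv W).map (diag α t c).toLinearMap

variable {ι : Type*} [Fintype ι]

/-- The half-Dirac operator `D_x = ∑ᵢ xᵢ ⊗ yᵢ`, with `yᵢ` a basis of `h` and `xᵢ` its dual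
basis. -/
def diracX (b : Module.Basis ι ℂ h) : HC α t c :=
  ∑ i, Cherednik.x α t c (b.coord i) ⊗ₜ[ℂ] cliffY (b i)

/-- The half-Dirac operator `D_y = ∑ᵢ yᵢ ⊗ xᵢ`. -/
def diracY (b : Module.Basis ι ℂ h) : HC α t c :=
  ∑ i, Cherednik.y α t c (b i) ⊗ₜ[ℂ] cliffX (b.coord i)

variable {α t c} in
/-- The odd derivation `a ↦ D a - ε(a) D` of `H ⊗ C(V)`. -/
def oddDer (D : HC α t c) : HC α t c →ₗ[ℂ] HC α t c :=
  LinearMap.mulLeft ℂ D - LinearMap.mulRight ℂ D ∘ₗ (parity α t c).toLinearMap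

end

end HalfDirac

end

noncomputable section

set_option linter.unusedSectionVars false

namespace HalfDirac

/-! The derivation `δ` attached to `D_x` behaves like a Koszul differential: it kills `x ⊗ 1` and
sends `1 ⊗ x` to `-2 (x ⊗ 1)`. It is inverted by a de Rham homotopy. Let `d i` be operators on `H`
with `d i (x a) = ⟨x, yᵢ⟩ a + x (d i a)` that vanish on the subalgebra generated by `h` and `W`, and
let `s` be the sum of the `d i` tensored with left multiplication by `xᵢ`. On a product of `n`
elements of `h*`, then `d` elements of `h`, then some `Δ(w̃)`, with vectors and forms taken in
either tensor factor, `L = δ s + s δ` acts by `-2n` (`Homog.L_eq`).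

Such products span `H ⊗ C(V)` (`homogSpan_eq_top`) and have `ℂˣ`-weight `d - n`. In weight zero, `n
= 0` forces `d = 0`, so only the image of `Δ` is left, and on the remaining products `L` has nonzero
eigenvalues. As `L` commutes with `δ`, a cocycle is a coboundary plus an element `Δ(z)`
(`exists_eq_δ_add`). A coboundary of the form `Δ(z)` is killed by `L` and hence zero (`δ_eq_zero`).
Averaging over `W` passes to the invariants of the cover.

The operators `d i` are built without a PBW theorem. Dunkl operators turn `ℂ[X] ⊗ H` into an
`H`-module. The map `a ↦ a · (1 ⊗ 1)` is split by multiplication `ℂ[X] ⊗ H → H`, and this transports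
the partial derivatives to `H` (`exists_pderiv`). Linear independence of the products above is never
used; independence of eigenspaces replaces it.

The argument also needs the elements of the Pin cover of `W` to be even and fixed by `ℂˣ`
(`evenInv_of_mem_pinCover`). A pseudo-reflection acts on `h* ⊕ h` as a product of two orthogonal
reflections, which gives such lifts. Elements over `1` have both properties because the `ℂˣ`-action
is conjugation by an element commuting with them.

Everything is stated for abstract data `X`, `Y`, so that `D_y` is handled by exchanging `h` and
`h*`. -/

/-! ### Abstract Cherednik data and Dunkl operators -/

/-- Two representations `X`, `Y` of a finite group `W`, with the coefficients
`⟨y, x⟩ + ∑ₛ θₛ(y) βₛ(x) s` of a commutation relation of Cherednik type. -/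
structure DunklDatum (W X Y : Type*) [Group W] [AddCommGroup X] [Module ℂ X]
    [AddCommGroup Y] [Module ℂ Y] where
  actX : W →* Module.End ℂ X
  actY : W →* Module.End ℂ Y
  pair : Y →ₗ[ℂ] X →ₗ[ℂ] ℂ
  θ : W → Y →ₗ[ℂ] ℂ
  β : W → X →ₗ[ℂ] ℂ
  a : W → X
  pair_act : ∀ w y x, pair (actY w y) (actX w x) = pair y x
  coeff_conj : ∀ w s y x,
    θ (w * s * w⁻¹) (actY w y) * β (w * s * w⁻¹) (actX w x) = θ s y * β s x
  a_ne_zero : ∀ s, θ s ≠ 0 → a s ≠ 0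
  actX_sub : ∀ s, θ s ≠ 0 → ∀ x, actX s x - x = β s x • a s
  -- Expresses that `s - 1` on `Y` has rank at most one with `θ s` as its linear form, when `θ s ≠
  -- 0`. This is what makes the Dunkl operators commute.
  θ_symm : ∀ s y y', θ s y • (actY s y' - y') = θ s y' • (actY s y - y)

/-- Elements of an algebra satisfying the relations of Cherednik type given by a datum. -/
structure DunklDatum.Rep {W X Y : Type*} [Group W] [Fintype W] [AddCommGroup X] [Module ℂ X]
    [AddCommGroup Y] [Module ℂ Y] (D : DunklDatum W X Y) (H : Type*) [Ring H] [Algebra ℂ H] where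
  x : X →ₗ[ℂ] H
  y : Y →ₗ[ℂ] H
  g : W →* H
  g_x : ∀ w v, g w * x v = x (D.actX w v) * g w
  g_y : ∀ w v, g w * y v = y (D.actY w v) * g w
  x_comm : ∀ v v', x v * x v' = x v' * x v
  y_comm : ∀ v v', y v * y v' = y v' * y v
  y_x : ∀ v f, y v * x f = x f * y v + (D.pair v f • 1 + ∑ s, (D.θ s v * D.β s f) • g s)

/-- Linear polynomials, in the coordinates of a basis. -/
def linPoly {X ι : Type*} [AddCommGroup X] [Module ℂ X] (b : Module.Basis ι ℂ X) :
    X →ₗ[ℂ] MvPolynomial ι ℂ :=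
  b.constr ℂ MvPolynomial.X

/-! ### Polynomials and divided differences -/

section

variable {X ι : Type*} [AddCommGroup X] [Module ℂ X] (b : Module.Basis ι ℂ X)

@[simp]
theorem linPoly_basis (i : ι) : linPoly b (b i) = MvPolynomial.X i := by
  simp [linPoly, Module.Basis.constr_basis]

theorem linPoly_injective : Function.Injective (linPoly b) := by
  have h : Function.Injective (Finsupp.linearCombination ℂ (MvPolynomial.X (R := ℂ) (σ := ι))) :=
    MvPolynomial.linearIndependent_X ι ℂ
  have e : ⇑(linPoly b) = Finsupp.linearCombination ℂ MvPolynomial.X ∘ b.repr := by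
    funext v; simp [linPoly, Module.Basis.constr_apply, Finsupp.linearCombination_apply]
  exact e ▸ h.comp b.repr.injective

/-- The algebra endomorphism of polynomials induced by an endomorphism of linear forms. -/
def polyMap (f : Module.End ℂ X) : MvPolynomial ι ℂ →ₐ[ℂ] MvPolynomial ι ℂ :=
  MvPolynomial.aeval fun i => linPoly b (f (b i))

theorem polyMap_linPoly (f : Module.End ℂ X) (v : X) :
    polyMap b f (linPoly b v) = linPoly b (f v) := by
  have : (polyMap b f).toLinearMap ∘ₗ linPoly b = linPoly b ∘ₗ f :=
    b.ext fun i => by simp [polyMap]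
  exact LinearMap.congr_fun this v

theorem polyMap_one : polyMap b 1 = AlgHom.id ℂ _ := by
  ext i; simp [polyMap]

theorem polyMap_mul (f f' : Module.End ℂ X) :
    polyMap b (f * f') = (polyMap b f).comp (polyMap b f') := by
  refine MvPolynomial.algHom_ext fun i => ?_
  simp only [← linPoly_basis b, AlgHom.comp_apply, polyMap_linPoly, Module.End.mul_apply]

/-- Modulo the linear form of `a`, the endomorphism `f` is the identity on the variables, hence on
all polynomials. -/
theorem dvd_polyMap_sub {f : Module.End ℂ X} {a : X}
    (hf : ∀ v, ∃ r : ℂ, f v - v = r • a) (p : MvPolynomial ι ℂ) :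
    linPoly b a ∣ polyMap b f p - p := by
  induction p using MvPolynomial.induction_on with
  | C r => simp [MvPolynomial.algHom_C]
  | add p q hp hq => rw [map_add, add_sub_add_comm]; exact dvd_add hp hq
  | mul_X p i hp =>
    obtain ⟨r, hr⟩ := hf (b i)
    have : polyMap b f (p * MvPolynomial.X i) - p * MvPolynomial.X i =
        (polyMap b f p - p) * polyMap b f (MvPolynomial.X i) + p * linPoly b (f (b i) - b i) := by
      rw [map_mul, map_sub, linPoly_basis, ← polyMap_linPoly, linPoly_basis]; ring
    rw [this, hr, map_smul, Algebra.smul_def]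
    exact dvd_add (Dvd.dvd.mul_right hp _) ⟨p * algebraMap ℂ _ r, by ring⟩

/-- The divided difference `p ↦ (f p - p) / a` of an endomorphism `f` with `f - 1` of rank one. -/
theorem exists_dividedDiff {f : Module.End ℂ X} {a : X} (ha : a ≠ 0) {β : X →ₗ[ℂ] ℂ}
    (hf : ∀ v, f v - v = β v • a) :
    ∃ d : Module.End ℂ (MvPolynomial ι ℂ), d 1 = 0 ∧
      ∀ v p, d (linPoly b v * p) = β v • polyMap b f p + linPoly b v * d p := by
  have h0 : linPoly b a ≠ 0 := (map_ne_zero_iff _ (linPoly_injective b)).2 ha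
  -- The quotient is unique, since polynomials form a domain and `a ≠ 0`. Linearity and the twisted
  -- Leibniz rule can thus be checked after multiplying by `a`.
  choose d hd using dvd_polyMap_sub b (f := f) (a := a) fun v => ⟨β v, hf v⟩
  refine ⟨⟨⟨d, fun p q => ?_⟩, fun r p => ?_⟩, ?_, fun v p => ?_⟩
  · apply mul_left_cancel₀ h0
    rw [← hd, mul_add, ← hd, ← hd, map_add]; ring
  · apply mul_left_cancel₀ h0
    rw [← hd, map_smul, RingHom.id_apply, mul_smul_comm, ← hd, smul_sub]
  · apply mul_left_cancel₀ h0
    change linPoly b a * d 1 = _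
    rw [← hd]; simp
  · apply mul_left_cancel₀ h0
    change linPoly b a * d _ = _ * (_ + _ * d p)
    have e : polyMap b f (linPoly b v) = linPoly b v + β v • linPoly b a := by
      rw [polyMap_linPoly, ← map_smul, ← hf, ← map_add, add_sub_cancel]
    rw [← hd, map_mul, e, mul_add, mul_left_comm _ _ (d p), ← hd, Algebra.smul_def,
      Algebra.smul_def]
    ring

end

/-! ### Dunkl operators with coefficients in the algebra -/

section

variable {W X Y ι H : Type*} [Group W] [Fintype W] [AddCommGroup X] [Module ℂ X]
    [AddCommGroup Y] [Module ℂ Y] [Fintype ι] [Ring H] [Algebra ℂ H]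
    {D : DunklDatum W X Y} (b : Module.Basis ι ℂ X) (R : D.Rep H)

namespace DunklDatum

/-- If `θ s = 0` the zero operator is a harmless default: in the Dunkl operators the divided
difference of `s` occurs only multiplied by `θ s`. -/
theorem exists_diff (D : DunklDatum W X Y) (s : W) :
    ∃ d : Module.End ℂ (MvPolynomial ι ℂ), d 1 = 0 ∧
      ∀ v p, D.θ s ≠ 0 →
        d (linPoly b v * p) = D.β s v • polyMap b (D.actX s) p + linPoly b v * d p := by
  by_cases h : D.θ s = 0
  · exact ⟨0, rfl, fun _ _ h' => (h' h).elim⟩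
  · obtain ⟨d, h1, h2⟩ := exists_dividedDiff b (D.a_ne_zero s h) (D.actX_sub s h)
    exact ⟨d, h1, fun v p _ => h2 v p⟩

/-- The divided difference operator attached to an element `s` with `θₛ ≠ 0`. -/
def diff (D : DunklDatum W X Y) (s : W) : Module.End ℂ (MvPolynomial ι ℂ) :=
  (D.exists_diff b s).choose

theorem diff_one (s : W) : D.diff b s 1 = 0 := (D.exists_diff b s).choose_spec.1

theorem diff_mul (s : W) (h : D.θ s ≠ 0) (v : X) (p : MvPolynomial ι ℂ) :
    D.diff b s (linPoly b v * p) =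
      D.β s v • polyMap b (D.actX s) p + linPoly b v * D.diff b s p :=
  (D.exists_diff b s).choose_spec.2 v p h

namespace Rep

/-- Multiplication by linear forms on polynomials with coefficients in `H`. -/
def opX : X →ₗ[ℂ] Module.End ℂ (MvPolynomial ι ℂ ⊗[ℂ] H) where
  toFun v := TensorProduct.map (LinearMap.mulLeft ℂ (linPoly b v)) LinearMap.id
  map_add' v v' := by ext; simp [add_mul, TensorProduct.add_tmul]
  map_smul' r v := by ext; simp [TensorProduct.smul_tmul']

@[simp]
theorem opX_tmul (v : X) (p : MvPolynomial ι ℂ) (m : H) :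
    opX b v (p ⊗ₜ m) = (linPoly b v * p) ⊗ₜ[ℂ] m := rfl

/-- The diagonal action of the group on polynomials with coefficients in `H`. -/
def opG : W →* Module.End ℂ (MvPolynomial ι ℂ ⊗[ℂ] H) where
  toFun w := TensorProduct.map (polyMap b (D.actX w)).toLinearMap (LinearMap.mulLeft ℂ (R.g w))
  map_one' := by ext; simp [polyMap_one]
  map_mul' w w' := by ext; simp [polyMap_mul]

@[simp]
theorem opG_tmul (w : W) (p : MvPolynomial ι ℂ) (m : H) :
    R.opG b w (p ⊗ₜ m) = (polyMap b (D.actX w) p) ⊗ₜ[ℂ] (R.g w * m) := rfl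

/-- The partial derivatives on polynomials with coefficients in `H`. -/
def opD (i : ι) : Module.End ℂ (MvPolynomial ι ℂ ⊗[ℂ] H) :=
  TensorProduct.map (MvPolynomial.pderiv i).toLinearMap LinearMap.id

@[simp]
theorem opD_tmul (i : ι) (p : MvPolynomial ι ℂ) (m : H) :
    opD i (p ⊗ₜ m) = (MvPolynomial.pderiv i p) ⊗ₜ[ℂ] m := rfl

/-- The divided differences on polynomials with coefficients in `H`. -/
def opN (s : W) : Module.End ℂ (MvPolynomial ι ℂ ⊗[ℂ] H) :=
  TensorProduct.map (D.diff b s) (LinearMap.mulLeft ℂ (R.g s))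

@[simp]
theorem opN_tmul (s : W) (p : MvPolynomial ι ℂ) (m : H) :
    R.opN b s (p ⊗ₜ m) = (D.diff b s p) ⊗ₜ[ℂ] (R.g s * m) := rfl

/-- The Dunkl operators on polynomials with coefficients in `H`. -/
def opY : Y →ₗ[ℂ] Module.End ℂ (MvPolynomial ι ℂ ⊗[ℂ] H) where
  toFun v := TensorProduct.map LinearMap.id (LinearMap.mulLeft ℂ (R.y v)) +
    ∑ i, D.pair v (b i) • opD i + ∑ s, D.θ s v • R.opN b s
  map_add' v v' := by
    ext
    simp [add_mul, add_smul, Finset.sum_add_distrib, TensorProduct.tmul_add]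
    abel
  map_smul' r v := by
    ext
    simp [mul_smul, Finset.smul_sum]

theorem opY_apply (v : Y) (n : MvPolynomial ι ℂ ⊗[ℂ] H) :
    R.opY b v n = TensorProduct.map LinearMap.id (LinearMap.mulLeft ℂ (R.y v)) n +
      ∑ i, D.pair v (b i) • opD i n + ∑ s, D.θ s v • R.opN b s n := by
  simp [opY]

@[simp]
theorem opY_one_tmul (v : Y) (m : H) :
    R.opY b v (1 ⊗ₜ m) = 1 ⊗ₜ[ℂ] (R.y v * m) := by
  simp [opY_apply, diff_one]

theorem opD_opX (i : ι) (v : X) (n : MvPolynomial ι ℂ ⊗[ℂ] H) :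
    opD i (opX b v n) = b.coord i v • n + opX b v (opD i n) := by
  have key : MvPolynomial.pderiv i (linPoly b v) = MvPolynomial.C (b.coord i v) := by
    have : (MvPolynomial.pderiv i).toLinearMap ∘ₗ linPoly b =
        (Algebra.linearMap ℂ (MvPolynomial ι ℂ)) ∘ₗ b.coord i := by
      classical
      refine b.ext fun j => ?_
      simp [MvPolynomial.pderiv_X, Pi.single_apply, Finsupp.single_apply]
    exact LinearMap.congr_fun this v
  induction n with
  | zero => simp
  | add n n' h h' => simp only [map_add, h, h', smul_add]; abel
  | tmul p m =>
    simp only [opX_tmul, opD_tmul, Derivation.leibniz, key, smul_eq_mul]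
    rw [TensorProduct.add_tmul, add_comm, mul_comm, ← MvPolynomial.smul_eq_C_mul,
      TensorProduct.smul_tmul']

/-- The common factor `θ s y` allows for the `s` with `θ s = 0`, for which no Leibniz rule is
available. -/
theorem opN_opX (s : W) (y : Y) (v : X) (n : MvPolynomial ι ℂ ⊗[ℂ] H) :
    D.θ s y • R.opN b s (opX b v n) =
      D.θ s y • (D.β s v • R.opG b s n + opX b v (R.opN b s n)) := by
  by_cases h : D.θ s = 0
  · simp [h]
  congr 1
  induction n with
  | zero => simp
  | add n n' h h' => simp only [map_add, h, h', smul_add]; abel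
  | tmul p m =>
    simp only [opX_tmul, opN_tmul, D.diff_mul b s h, opG_tmul, TensorProduct.add_tmul,
      TensorProduct.smul_tmul']

/-- The Leibniz rule of the partial derivatives produces the pairing term, and the twisted Leibniz
rule of the divided differences produces the group terms. Multiplication by `R.y y` on coefficients
contributes nothing. -/
theorem opY_opX (y : Y) (v : X) (n : MvPolynomial ι ℂ ⊗[ℂ] H) :
    R.opY b y (opX b v n) = opX b v (R.opY b y n) +
      (D.pair y v • n + ∑ s, (D.θ s y * D.β s v) • R.opG b s n) := by
  have h1 : TensorProduct.map LinearMap.id (LinearMap.mulLeft ℂ (R.y y)) (opX b v n) =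
      opX b v (TensorProduct.map LinearMap.id (LinearMap.mulLeft ℂ (R.y y)) n) := by
    induction n with
    | zero => simp
    | add n n' h h' => simp only [map_add, h, h']
    | tmul p m => simp
  have h2 : D.pair y v • n = ∑ i, D.pair y (b i) • b.coord i v • n := by
    conv_lhs => rw [← b.sum_repr v]
    simp only [map_sum, map_smul, Finset.sum_smul, smul_eq_mul, smul_smul, Module.Basis.coord_apply,
      mul_comm]
  rw [opY_apply, opY_apply, h1, h2]
  simp only [opD_opX, opN_opX, smul_add, Finset.sum_add_distrib, map_add, map_sum, map_smul,
    mul_smul]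
  abel

theorem opG_opX (w : W) (v : X) (n : MvPolynomial ι ℂ ⊗[ℂ] H) :
    R.opG b w (opX b v n) = opX b (D.actX w v) (R.opG b w n) := by
  induction n with
  | zero => simp
  | add n n' h h' => simp only [map_add, h, h']
  | tmul p m => simp [polyMap_linPoly]

theorem opX_comm (v v' : X) (n : MvPolynomial ι ℂ ⊗[ℂ] H) :
    opX b v (opX b v' n) = opX b v' (opX b v n) := by
  induction n with
  | zero => simp
  | add n n' h h' => simp only [map_add, h, h']
  | tmul p m => simp [mul_left_comm]

/-- A linear map vanishing on constants, whose kernel is stable under multiplication by linear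
forms, is zero. -/
theorem eq_zero_of_opX {P : Type*} [AddCommGroup P] [Module ℂ P]
    (Z : (MvPolynomial ι ℂ ⊗[ℂ] H) →ₗ[ℂ] P) (h1 : ∀ m, Z (1 ⊗ₜ m) = 0)
    (hX : ∀ v n, Z n = 0 → Z (opX b v n) = 0) (n : MvPolynomial ι ℂ ⊗[ℂ] H) : Z n = 0 := by
  induction n with
  | zero => simp
  | add n n' h h' => rw [map_add, h, h', add_zero]
  | tmul p m =>
    induction p using MvPolynomial.induction_on with
    | C r =>
      rw [MvPolynomial.C_eq_smul_one, TensorProduct.smul_tmul, h1]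
    | add p q hp hq => rw [TensorProduct.add_tmul, map_add, hp, hq, add_zero]
    | mul_X p i hp =>
      have := hX (b i) _ hp
      rwa [opX_tmul, linPoly_basis, mul_comm] at this

/-- On constants this is the relation in `H`. It propagates under multiplication by linear forms
because the commutators of `opY` with `opX` are equivariant. -/
theorem opG_opY (w : W) (y : Y) (n : MvPolynomial ι ℂ ⊗[ℂ] H) :
    R.opG b w (R.opY b y n) = R.opY b (D.actY w y) (R.opG b w n) := by
  rw [← sub_eq_zero]
  refine eq_zero_of_opX b (R.opG b w ∘ₗ R.opY b y - R.opY b (D.actY w y) ∘ₗ R.opG b w)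
    (fun m => ?_) (fun v n hn => ?_) n
  · simp only [LinearMap.sub_apply, LinearMap.comp_apply, opY_one_tmul, opG_tmul, map_one]
    rw [← mul_assoc, R.g_y, mul_assoc, sub_self]
  · simp only [LinearMap.sub_apply, LinearMap.comp_apply, sub_eq_zero] at hn ⊢
    -- Reindex by `s ↦ w s w⁻¹` and use the conjugation invariance of the coefficients.
    have h : ∑ s, (D.θ s (D.actY w y) * D.β s (D.actX w v)) • R.opG b s (R.opG b w n) =
        ∑ s, (D.θ s y * D.β s v) • R.opG b w (R.opG b s n) := by
      refine (Fintype.sum_equiv (MulAut.conj w).toEquiv _ _ fun s => ?_).symm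
      simp only [MulEquiv.toEquiv_eq_coe, EquivLike.coe_coe, MulAut.conj_apply, D.coeff_conj,
        ← Module.End.mul_apply, ← map_mul]
      simp
    simp only [opY_opX, opG_opX, map_add, hn, D.pair_act, map_sum, map_smul, h]

/-- The commutator of two Dunkl operators vanishes on constants. By the Jacobi identity it commutes
with multiplication by linear forms as soon as `[[y, x], y']` is symmetric in `y` and `y'`. -/
theorem opY_comm (y y' : Y) (n : MvPolynomial ι ℂ ⊗[ℂ] H) :
    R.opY b y (R.opY b y' n) = R.opY b y' (R.opY b y n) := by
  rw [← sub_eq_zero]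
  refine eq_zero_of_opX b (R.opY b y ∘ₗ R.opY b y' - R.opY b y' ∘ₗ R.opY b y)
    (fun m => ?_) (fun v n hn => ?_) n
  · simp only [LinearMap.sub_apply, LinearMap.comp_apply, opY_one_tmul]
    rw [← mul_assoc, R.y_comm, mul_assoc, sub_self]
  · simp only [LinearMap.sub_apply, LinearMap.comp_apply, sub_eq_zero] at hn ⊢
    -- Moving `s` past `y'` replaces `y'` by `s y'`, after which the equality holds term by term by
    -- `θ_symm`.
    have h : ∑ s, (D.θ s y * D.β s v) • R.opG b s (R.opY b y' n) +
          ∑ s, (D.θ s y' * D.β s v) • R.opY b y (R.opG b s n) =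
        ∑ s, (D.θ s y' * D.β s v) • R.opG b s (R.opY b y n) +
          ∑ s, (D.θ s y * D.β s v) • R.opY b y' (R.opG b s n) := by
      rw [← Finset.sum_add_distrib, ← Finset.sum_add_distrib]
      refine Finset.sum_congr rfl fun s _ => ?_
      have e := congrArg (fun z => D.β s v • R.opY b z (R.opG b s n)) (D.θ_symm s y y')
      simp only [map_smul, map_sub, LinearMap.smul_apply, LinearMap.sub_apply, smul_sub,
        smul_smul] at e
      rw [opG_opY, opG_opY]
      rw [mul_comm (D.θ s y), mul_comm (D.θ s y')]
      rw [sub_eq_sub_iff_add_eq_add] at e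
      exact e
    simp only [opY_opX, map_add, hn, map_sum, map_smul]
    have h' := congrArg (fun z => opX b v (R.opY b y' (R.opY b y n)) +
      D.pair y v • R.opY b y' n + D.pair y' v • R.opY b y n + z) h
    convert h' using 1 <;> abel

/-- The induced representation of the Cherednik relations on polynomials with coefficients
in `H`. -/
def induced : D.Rep (Module.End ℂ (MvPolynomial ι ℂ ⊗[ℂ] H)) where
  x := opX b
  y := R.opY b
  g := R.opG b
  g_x w v := LinearMap.ext fun n => R.opG_opX b w v n
  g_y w v := LinearMap.ext fun n => R.opG_opY b w v n
  x_comm v v' := LinearMap.ext fun n => opX_comm b v v' n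
  y_comm v v' := LinearMap.ext fun n => R.opY_comm b v v' n
  y_x v f := LinearMap.ext fun n => by simp [opY_opX]

/-! ### Partial derivatives on the algebra -/

-- The multiplication map `p ⊗ m ↦ p m`. Evaluation of polynomials needs a commutative target, so it
-- goes through the subalgebra generated by the commuting elements `R.x v`. No injectivity is
-- claimed.
open scoped IsMulCommutative in
theorem exists_mulMap : ∃ r : (MvPolynomial ι ℂ ⊗[ℂ] H) →ₗ[ℂ] H,
    (∀ m, r (1 ⊗ₜ m) = m) ∧ ∀ v n, r (opX b v n) = R.x v * r n := by
  have hc : ∀ a ∈ Set.range R.x, ∀ a' ∈ Set.range R.x, a * a' = a' * a := by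
    rintro _ ⟨v, rfl⟩ _ ⟨v', rfl⟩
    exact R.x_comm v v'
  have := Algebra.isMulCommutative_adjoin ℂ hc
  let φ : MvPolynomial ι ℂ →ₐ[ℂ] Algebra.adjoin ℂ (Set.range R.x) :=
    MvPolynomial.aeval fun i =>
      (⟨R.x (b i), Algebra.subset_adjoin ⟨_, rfl⟩⟩ : Algebra.adjoin ℂ (Set.range R.x))
  let φ' : MvPolynomial ι ℂ →ₐ[ℂ] H := (Algebra.adjoin ℂ (Set.range R.x)).val.comp φ
  have hφ (v : X) : φ' (linPoly b v) = R.x v := by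
    have : φ'.toLinearMap ∘ₗ linPoly b = R.x := b.ext fun i => by simp [φ', φ]
    exact LinearMap.congr_fun this v
  refine ⟨TensorProduct.lift ((LinearMap.mul ℂ H) ∘ₗ φ'.toLinearMap), fun m => by simp,
    fun v n => ?_⟩
  induction n with
  | zero => simp
  | add n n' h h' => simp only [map_add, h, h', mul_add]
  | tmul p m => simp [hφ, mul_assoc]

/-- If `H` acts on the induced representation, there are partial derivatives on `H` along the
linear forms, vanishing on the subalgebra generated by the vectors and the group. -/
theorem exists_pderiv (Ψ : H →ₐ[ℂ] Module.End ℂ (MvPolynomial ι ℂ ⊗[ℂ] H))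
    (hx : ∀ v, Ψ (R.x v) = opX b v) (hy : ∀ v, Ψ (R.y v) = R.opY b v)
    (hg : ∀ w, Ψ (R.g w) = R.opG b w)
    (hgen : Algebra.adjoin ℂ (Set.range R.x ∪ Set.range R.y ∪ Set.range R.g) = ⊤) :
    ∃ d : ι → Module.End ℂ H,
      (∀ i v a, d i (R.x v * a) = b.coord i v • a + R.x v * d i a) ∧
      ∀ i, ∀ a ∈ Algebra.adjoin ℂ (Set.range R.y ∪ Set.range R.g), d i a = 0 := by
  obtain ⟨r, hr1, hrx⟩ := R.exists_mulMap b
  have hrg (w : W) (n) : r (R.opG b w n) = R.g w * r n := by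
    rw [← sub_eq_zero]
    refine eq_zero_of_opX b (r ∘ₗ R.opG b w - LinearMap.mulLeft ℂ (R.g w) ∘ₗ r)
      (fun m => ?_) (fun v n hn => ?_) n
    · simp [hr1]
    · simp only [LinearMap.sub_apply, LinearMap.comp_apply, LinearMap.mulLeft_apply,
        sub_eq_zero] at hn ⊢
      rw [opG_opX, hrx, hn, hrx, ← mul_assoc, ← mul_assoc, R.g_x]
  have hry (y : Y) (n) : r (R.opY b y n) = R.y y * r n := by
    rw [← sub_eq_zero]
    refine eq_zero_of_opX b (r ∘ₗ R.opY b y - LinearMap.mulLeft ℂ (R.y y) ∘ₗ r)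
      (fun m => ?_) (fun v n hn => ?_) n
    · simp [hr1]
    · simp only [LinearMap.sub_apply, LinearMap.comp_apply, LinearMap.mulLeft_apply,
        sub_eq_zero] at hn ⊢
      simp only [opY_opX, map_add, hrx, hn, map_smul, map_sum, hrg]
      rw [← mul_assoc (R.y y), R.y_x]
      simp only [add_mul, mul_assoc, Finset.sum_mul, smul_mul_assoc, one_mul]
  have hr (a : H) (n) : r (Ψ a n) = a * r n := by
    have ha : a ∈ Algebra.adjoin ℂ (Set.range R.x ∪ Set.range R.y ∪ Set.range R.g) :=
      hgen ▸ Algebra.mem_top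
    induction ha using Algebra.adjoin_induction generalizing n with
    | mem a ha =>
      rcases ha with (⟨v, rfl⟩ | ⟨v, rfl⟩) | ⟨w, rfl⟩
      · rw [hx, hrx]
      · rw [hy, hry]
      · rw [hg, hrg]
    | algebraMap c => simp [Algebra.algebraMap_eq_smul_one]
    | add a a' _ _ h h' => rw [map_add, LinearMap.add_apply, map_add, h, h', add_mul]
    | mul a a' _ _ h h' => rw [map_mul, Module.End.mul_apply, h, h', mul_assoc]
  -- `ψ` writes an element with its linear forms on the left, as a polynomial with coefficients in
  -- `H`. The map `r` multiplies back, so that `r ∘ ∂ᵢ ∘ ψ` differentiates the polynomial part.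
  let ψ : H →ₗ[ℂ] MvPolynomial ι ℂ ⊗[ℂ] H := LinearMap.applyₗ (1 ⊗ₜ 1) ∘ₗ Ψ.toLinearMap
  have hrψ (a : H) : r (ψ a) = a := by
    change r (Ψ a (1 ⊗ₜ 1)) = a
    rw [hr, hr1, mul_one]
  refine ⟨fun i => r ∘ₗ opD i ∘ₗ ψ, fun i v a => ?_, fun i a ha => ?_⟩
  · have : ψ (R.x v * a) = opX b v (ψ a) := by
      change Ψ _ _ = opX b v (Ψ a _)
      rw [map_mul, hx]; rfl
    simp only [LinearMap.comp_apply, this, opD_opX, map_add, map_smul, hrψ, hrx]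
  -- Constants are stable under vectors and group elements, and the partial derivatives kill them.
  -- Arbitrary `m` is needed for the induction over products.
  · have hψ : ∀ m : H, Ψ a (1 ⊗ₜ m) = 1 ⊗ₜ (a * m) := by
      induction ha using Algebra.adjoin_induction with
      | mem a ha =>
        rcases ha with ⟨v, rfl⟩ | ⟨w, rfl⟩
        · intro m; rw [hy, opY_one_tmul]
        · intro m; rw [hg, opG_tmul, map_one]
      | algebraMap c => simp [Algebra.algebraMap_eq_smul_one]
      | add a a' _ _ h h' =>
        intro m; rw [map_add, LinearMap.add_apply, h, h', add_mul, TensorProduct.tmul_add]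
      | mul a a' _ _ h h' => intro m; rw [map_mul, Module.End.mul_apply, h', h, mul_assoc]
    change r (opD i (Ψ a (1 ⊗ₜ 1))) = 0
    simp [hψ]

end Rep

end DunklDatum

end

/-! ### Averaging -/

section

variable {G W V : Type*} [Group G] [Group W] [Fintype W] [AddCommGroup V] [Module ℂ V]

/-- The average of a representation of `G` over the finite quotient `W`, given lifts of the
elements of `W`. -/
def average (ρ : G →* Module.End ℂ V) (lift : W → G) : Module.End ℂ V :=
  (Fintype.card W : ℂ)⁻¹ • ∑ w, ρ (lift w)

theorem average_eq_self (ρ : G →* Module.End ℂ V) (lift : W → G) {v : V}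
    (hv : ∀ q, ρ q v = v) : average ρ lift v = v := by
  simp [average, hv, ← Nat.cast_smul_eq_nsmul ℂ, smul_smul]

/-- As the kernel of `π` acts trivially, `ρ` factors through `W`, where the usual translation of the
sum applies. Finiteness of `G` is not needed. -/
theorem apply_average (ρ : G →* Module.End ℂ V) {π : G →* W} {lift : W → G}
    (hl : ∀ w, π (lift w) = w) (hk : ∀ k, π k = 1 → ρ k = 1) (q : G) (v : V) :
    ρ q (average ρ lift v) = average ρ lift v := by
  have key (g g' : G) (h : π g = π g') : ρ g = ρ g' := by
    have := hk (g * g'⁻¹) (by simp [h])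
    calc ρ g = ρ (g * g'⁻¹) * ρ g' := by rw [← map_mul, inv_mul_cancel_right]
      _ = ρ g' := by rw [this, one_mul]
  have h : ∑ w, ρ q (ρ (lift w) v) = ∑ w, ρ (lift w) v := by
    refine Fintype.sum_equiv (Equiv.mulLeft (π q)) _ _ fun w => ?_
    rw [← Module.End.mul_apply, ← map_mul, key (q * lift w) (lift (π q * w)) (by simp [hl])]
    rfl
  simp [average, LinearMap.sum_apply, h]

end

/-! ### Complements in sums of independent submodules -/

/-- Write `a` as an element of `N j` plus a sum over the other indices. That sum lies both in `E j`
and in the span of the other `E k`, so it vanishes. -/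
theorem mem_of_iSupIndep {κ V : Type*} [AddCommGroup V] [Module ℂ V] {E N : κ → Submodule ℂ V}
    (hE : iSupIndep E) (hN : ∀ k, N k ≤ E k) (htop : ⨆ k, N k = ⊤) {j : κ} {a : V}
    (ha : a ∈ E j) : a ∈ N j := by
  have h : a ∈ N j ⊔ ⨆ (k) (_ : k ≠ j), N k := by
    rw [← iSup_split_single, htop]; trivial
  obtain ⟨n, hn, m, hm, rfl⟩ := Submodule.mem_sup.1 h
  have hm' : m ∈ ⨆ (k) (_ : k ≠ j), E k :=
    (iSup_mono fun k => iSup_mono fun _ => hN k : _ ≤ _) hm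
  have hmj : m ∈ E j := by simpa using sub_mem ha (hN j hn)
  rw [Submodule.disjoint_def.1 (hE j) m hmj hm', add_zero]
  exact hn

/-! ### The odd derivation attached to a half-Dirac operator -/

section

variable {W X Y H : Type*} [Group W] [Fintype W] [AddCommGroup X] [Module ℂ X]
  [AddCommGroup Y] [Module ℂ Y] [Ring H] [Algebra ℂ H] {D : DunklDatum W X Y}

/-- The structures needed to define the half-Dirac operator `∑ᵢ xᵢ ⊗ yᵢ` in `H ⊗ C`: an algebra
`C` with Clifford relations, a covering `G` of `W` mapping to even elements of `C`, an action of
`ℂˣ`, and partial derivatives on `H`. -/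
structure DiracDatum (R : D.Rep H) (C G ι : Type*) [Ring C] [Algebra ℂ C] [Group G]
    [Fintype ι] where
  cX : X →ₗ[ℂ] C
  cY : Y →ₗ[ℂ] C
  P : X →ₗ[ℂ] Y →ₗ[ℂ] ℂ
  b : ι → X
  b' : ι → Y
  expand_x : ∀ v, ∑ i, P v (b' i) • b i = v
  expand_y : ∀ v, ∑ i, P (b i) v • b' i = v
  P_act : ∀ w v v', P (D.actX w v) (D.actY w v') = P v v'
  cX_anti : ∀ v v', cX v * cX v' = -(cX v' * cX v)
  cY_anti : ∀ v v', cY v * cY v' = -(cY v' * cY v)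
  cY_cX : ∀ v v', cY v * cX v' = -(cX v' * cY v) - (2 * P v' v) • 1
  parity : C →ₐ[ℂ] C
  parity_cX : ∀ v, parity (cX v) = -cX v
  parity_cY : ∀ v, parity (cY v) = -cY v
  adjoin_C : Algebra.adjoin ℂ (Set.range cX ∪ Set.range cY) = ⊤
  adjoin_H : Algebra.adjoin ℂ (Set.range R.x ∪ Set.range R.y ∪ Set.range R.g) = ⊤
  u : G →* C
  π : G →* W
  π_surjective : Function.Surjective π
  u_cX : ∀ q v, u q * cX v = cX (D.actX (π q) v) * u q
  u_cY : ∀ q v, u q * cY v = cY (D.actY (π q) v) * u q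
  parity_u : ∀ q, parity (u q) = u q
  ker_comm : ∀ k, π k = 1 → ∀ q, k * q = q * k
  d : ι → Module.End ℂ H
  d_x_mul : ∀ i v a, d i (R.x v * a) = P v (b' i) • a + R.x v * d i a
  d_eq_zero : ∀ i, ∀ a ∈ Algebra.adjoin ℂ (Set.range R.y ∪ Set.range R.g), d i a = 0
  σH : ℂˣ → H →ₐ[ℂ] H
  σC : ℂˣ → C →ₐ[ℂ] C
  σH_x : ∀ z v, σH z (R.x v) = (↑z⁻¹ : ℂ) • R.x v
  σH_y : ∀ z v, σH z (R.y v) = (z : ℂ) • R.y v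
  σH_g : ∀ z w, σH z (R.g w) = R.g w
  σC_cX : ∀ z v, σC z (cX v) = (↑z⁻¹ : ℂ) • cX v
  σC_cY : ∀ z v, σC z (cY v) = (z : ℂ) • cY v
  σC_u : ∀ z q, σC z (u q) = u q

namespace DiracDatum

variable {R : D.Rep H} {C G ι : Type*} [Ring C] [Algebra ℂ C] [Group G] [Fintype ι]
  (K : DiracDatum R C G ι)

/-- The linear forms, in the first factor. -/
def hX (_ : DiracDatum R C G ι) (v : X) : H ⊗[ℂ] C := R.x v ⊗ₜ 1

/-- The vectors, in the first factor. -/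
def hY (_ : DiracDatum R C G ι) (v : Y) : H ⊗[ℂ] C := R.y v ⊗ₜ 1

/-- The group elements, in the first factor. -/
def hG (_ : DiracDatum R C G ι) (w : W) : H ⊗[ℂ] C := R.g w ⊗ₜ 1

/-- The linear forms, in the second factor. -/
def kX (v : X) : H ⊗[ℂ] C := 1 ⊗ₜ K.cX v

/-- The vectors, in the second factor. -/
def kY (v : Y) : H ⊗[ℂ] C := 1 ⊗ₜ K.cY v

/-- The diagonal map. -/
def Δ : G →* H ⊗[ℂ] C where
  toFun q := R.g (K.π q) ⊗ₜ K.u q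
  map_one' := by simp [Algebra.TensorProduct.one_def]
  map_mul' q q' := by simp

/-- The parity automorphism. -/
def ε : H ⊗[ℂ] C →ₐ[ℂ] H ⊗[ℂ] C := Algebra.TensorProduct.map (AlgHom.id ℂ H) K.parity

/-- The action of `ℂˣ`. -/
def σ (z : ℂˣ) : H ⊗[ℂ] C →ₐ[ℂ] H ⊗[ℂ] C := Algebra.TensorProduct.map (K.σH z) (K.σC z)

/-- The half-Dirac operator. -/
def dirac : H ⊗[ℂ] C := ∑ i, R.x (K.b i) ⊗ₜ[ℂ] K.cY (K.b' i)

/-- The odd derivation attached to the half-Dirac operator. -/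
def δ : Module.End ℂ (H ⊗[ℂ] C) :=
  LinearMap.mulLeft ℂ K.dirac - LinearMap.mulRight ℂ K.dirac ∘ₗ K.ε.toLinearMap

/-- The homotopy operator. -/
def s : Module.End ℂ (H ⊗[ℂ] C) :=
  ∑ i, TensorProduct.map (K.d i) (LinearMap.mulLeft ℂ (K.cX (K.b i)))

theorem Δ_apply (q : G) : K.Δ q = R.g (K.π q) ⊗ₜ K.u q := rfl

theorem δ_apply (a : H ⊗[ℂ] C) : K.δ a = K.dirac * a - K.ε a * K.dirac := rfl

theorem ε_hX (v : X) : K.ε (K.hX v) = K.hX v := by simp [ε, hX]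
theorem ε_hY (v : Y) : K.ε (K.hY v) = K.hY v := by simp [ε, hY]
theorem ε_kX (v : X) : K.ε (K.kX v) = -K.kX v := by
  simp [ε, kX, K.parity_cX, TensorProduct.tmul_neg]
theorem ε_kY (v : Y) : K.ε (K.kY v) = -K.kY v := by
  simp [ε, kY, K.parity_cY, TensorProduct.tmul_neg]
theorem ε_Δ (q : G) : K.ε (K.Δ q) = K.Δ q := by simp [ε, Δ_apply, K.parity_u]

theorem ε_dirac : K.ε K.dirac = -K.dirac := by
  simp [dirac, ε, K.parity_cY, TensorProduct.tmul_neg]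

theorem σ_hX (z : ℂˣ) (v : X) : K.σ z (K.hX v) = (↑z⁻¹ : ℂ) • K.hX v := by
  simp [σ, hX, K.σH_x, TensorProduct.smul_tmul']
theorem σ_hY (z : ℂˣ) (v : Y) : K.σ z (K.hY v) = (z : ℂ) • K.hY v := by
  simp [σ, hY, K.σH_y, TensorProduct.smul_tmul']
theorem σ_kX (z : ℂˣ) (v : X) : K.σ z (K.kX v) = (↑z⁻¹ : ℂ) • K.kX v := by
  simp [σ, kX, K.σC_cX]
theorem σ_kY (z : ℂˣ) (v : Y) : K.σ z (K.kY v) = (z : ℂ) • K.kY v := by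
  simp [σ, kY, K.σC_cY]
theorem σ_Δ (z : ℂˣ) (q : G) : K.σ z (K.Δ q) = K.Δ q := by simp [σ, Δ_apply, K.σH_g, K.σC_u]

theorem σ_dirac (z : ℂˣ) : K.σ z K.dirac = K.dirac := by
  simp [σ, dirac, K.σH_x, K.σC_cY, TensorProduct.smul_tmul', smul_smul]

theorem ε_ε (a : H ⊗[ℂ] C) : K.ε (K.ε a) = a := by
  have h : K.parity.comp K.parity = AlgHom.id ℂ C := by
    refine AlgHom.ext_of_adjoin_eq_top K.adjoin_C ?_
    rintro _ (⟨v, rfl⟩ | ⟨v, rfl⟩) <;> simp [K.parity_cX, K.parity_cY]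
  have : K.ε.comp K.ε = AlgHom.id ℂ (H ⊗[ℂ] C) := by
    refine Algebra.TensorProduct.ext' fun p c => ?_
    have := DFunLike.congr_fun h c
    simp only [AlgHom.comp_apply, AlgHom.id_apply] at this
    simp [ε, this]
  exact DFunLike.congr_fun this a

theorem ε_σ (z : ℂˣ) (a : H ⊗[ℂ] C) : K.ε (K.σ z a) = K.σ z (K.ε a) := by
  have h : K.parity.comp (K.σC z) = (K.σC z).comp K.parity := by
    refine AlgHom.ext_of_adjoin_eq_top K.adjoin_C ?_
    rintro _ (⟨v, rfl⟩ | ⟨v, rfl⟩) <;> simp [K.parity_cX, K.parity_cY, K.σC_cX, K.σC_cY]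
  have : K.ε.comp (K.σ z) = (K.σ z).comp K.ε := by
    refine Algebra.TensorProduct.ext' fun p c => ?_
    have := DFunLike.congr_fun h c
    simp only [AlgHom.comp_apply] at this
    simp [ε, σ, this]
  exact DFunLike.congr_fun this a

theorem σ_δ (z : ℂˣ) (a : H ⊗[ℂ] C) : K.σ z (K.δ a) = K.δ (K.σ z a) := by
  simp [δ_apply, ε_σ, σ_dirac]

/-- The double sum is symmetric in the first factor and antisymmetric in the second, so exchanging
the indices changes its sign. -/
theorem dirac_mul_dirac : K.dirac * K.dirac = 0 := by
  have h : K.dirac * K.dirac = -(K.dirac * K.dirac) := by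
    conv_rhs => simp only [dirac, Finset.sum_mul_sum, Algebra.TensorProduct.tmul_mul_tmul]
    rw [Finset.sum_comm]
    simp only [dirac, Finset.sum_mul_sum, Algebra.TensorProduct.tmul_mul_tmul]
    simp only [← Finset.sum_neg_distrib, ← TensorProduct.tmul_neg]
    refine Finset.sum_congr rfl fun i _ => Finset.sum_congr rfl fun j _ => ?_
    rw [R.x_comm, K.cY_anti]
  have h2 : (2 : ℂ) • (K.dirac * K.dirac) = 0 := by
    rw [two_smul]; nth_rewrite 1 [h]; exact neg_add_cancel _
  simpa using h2

theorem δ_δ (a : H ⊗[ℂ] C) : K.δ (K.δ a) = 0 := by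
  have h1 : K.dirac * (K.dirac * a) = 0 := by rw [← mul_assoc, dirac_mul_dirac, zero_mul]
  have h2 : a * K.dirac * K.dirac = 0 := by rw [mul_assoc, dirac_mul_dirac, mul_zero]
  simp [δ_apply, ε_dirac, ε_ε, mul_sub, add_mul, h1, h2, mul_assoc] at h2 ⊢

theorem δ_mul (a a' : H ⊗[ℂ] C) : K.δ (a * a') = K.δ a * a' + K.ε a * K.δ a' := by
  simp only [δ_apply, map_mul, mul_sub, sub_mul, mul_assoc]
  abel

theorem δ_hX (v : X) : K.δ (K.hX v) = 0 := by
  rw [δ_apply, ε_hX]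
  simp [dirac, hX, Finset.sum_mul, Finset.mul_sum, R.x_comm v]

theorem δ_kY (v : Y) : K.δ (K.kY v) = 0 := by
  rw [δ_apply, ε_kY]
  simp [dirac, kY, Finset.sum_mul, Finset.mul_sum, K.cY_anti v, TensorProduct.tmul_neg]

/-- Only the scalar of the Clifford relation survives. The expansion of `v` in the dual families
reassembles these scalars. -/
theorem δ_kX (v : X) : K.δ (K.kX v) = (-2 : ℂ) • K.hX v := by
  rw [δ_apply, ε_kX]
  have : K.hX v = ∑ i, K.P v (K.b' i) • (R.x (K.b i) ⊗ₜ[ℂ] (1 : C)) := by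
    conv_lhs => rw [hX, ← K.expand_x v]
    simp [TensorProduct.sum_tmul, TensorProduct.smul_tmul']
  rw [this]
  simp only [dirac, kX, Finset.sum_mul, Finset.mul_sum, Algebra.TensorProduct.tmul_mul_tmul,
    K.cY_cX, neg_mul, mul_one, one_mul, Finset.smul_sum,
    Finset.sum_neg_distrib, sub_neg_eq_add]
  rw [← Finset.sum_add_distrib]
  refine Finset.sum_congr rfl fun i _ => ?_
  rw [TensorProduct.tmul_sub, TensorProduct.tmul_neg, TensorProduct.tmul_smul, smul_smul,
    neg_mul, neg_smul]
  abel

theorem Δ_hX (q : G) (v : X) : K.Δ q * K.hX v = K.hX (D.actX (K.π q) v) * K.Δ q := by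
  simp [Δ_apply, hX, R.g_x]
theorem Δ_hY (q : G) (v : Y) : K.Δ q * K.hY v = K.hY (D.actY (K.π q) v) * K.Δ q := by
  simp [Δ_apply, hY, R.g_y]
theorem Δ_kX (q : G) (v : X) : K.Δ q * K.kX v = K.kX (D.actX (K.π q) v) * K.Δ q := by
  simp [Δ_apply, kX, K.u_cX]
theorem Δ_kY (q : G) (v : Y) : K.Δ q * K.kY v = K.kY (D.actY (K.π q) v) * K.Δ q := by
  simp [Δ_apply, kY, K.u_cY]

/-- The half-Dirac operator comes from the canonical tensor of the invariant pairing `P`, which is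
fixed by the diagonal action. -/
theorem sum_act (w : W) :
    ∑ i, R.x (D.actX w (K.b i)) ⊗ₜ[ℂ] K.cY (D.actY w (K.b' i)) = K.dirac := by
  have h1 (i) : D.actY w (K.b' i) = ∑ j, K.P (D.actX w⁻¹ (K.b j)) (K.b' i) • K.b' j := by
    conv_lhs => rw [← K.expand_y (D.actY w (K.b' i))]
    refine Finset.sum_congr rfl fun j _ => ?_
    congr 1
    rw [← K.P_act w (D.actX w⁻¹ (K.b j)), ← Module.End.mul_apply (D.actX w), ← map_mul]
    simp
  have h2 (j) : ∑ i, K.P (D.actX w⁻¹ (K.b j)) (K.b' i) • D.actX w (K.b i) = K.b j := by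
    simp only [← map_smul, ← map_sum, K.expand_x]
    rw [← Module.End.mul_apply, ← map_mul]
    simp
  simp only [h1, map_sum, map_smul, TensorProduct.tmul_sum]
  rw [Finset.sum_comm]
  refine Finset.sum_congr rfl fun j _ => ?_
  conv_rhs => rw [← h2 j]
  simp [TensorProduct.sum_tmul, TensorProduct.smul_tmul']

theorem δ_Δ (q : G) : K.δ (K.Δ q) = 0 := by
  rw [δ_apply, ε_Δ, sub_eq_zero]
  conv_lhs => rw [← K.sum_act (K.π q)]
  simp [dirac, Δ_apply, Finset.sum_mul, Finset.mul_sum, R.g_x, K.u_cY]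

theorem δ_conj (q : G) (a : H ⊗[ℂ] C) :
    K.δ (K.Δ q * a * K.Δ q⁻¹) = K.Δ q * K.δ a * K.Δ q⁻¹ := by
  simp [δ_mul, δ_Δ, ε_Δ]

/-! #### The homotopy operator -/

/-- With `s_kX_mul`, this says that under left multiplication by linear forms `s` behaves as an odd
derivation with `x ⊗ 1 ↦ 1 ⊗ x ↦ 0`, opposite in direction to `δ`. -/
theorem s_hX_mul (v : X) (a : H ⊗[ℂ] C) : K.s (K.hX v * a) = K.kX v * a + K.hX v * K.s a := by
  induction a with
  | zero => simp
  | add a a' h h' => simp only [mul_add, map_add, h, h']; abel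
  | tmul p c =>
    have : K.kX v * p ⊗ₜ[ℂ] c = ∑ i, K.P v (K.b' i) • (p ⊗ₜ[ℂ] (K.cX (K.b i) * c)) := by
      conv_lhs => rw [kX, ← K.expand_x v]
      simp [TensorProduct.tmul_sum, Finset.sum_mul]
    rw [this]
    simp [s, hX, K.d_x_mul, TensorProduct.add_tmul, Finset.sum_add_distrib, Finset.mul_sum,
      TensorProduct.smul_tmul']

theorem s_kX_mul (v : X) (a : H ⊗[ℂ] C) : K.s (K.kX v * a) = -(K.kX v * K.s a) := by
  induction a with
  | zero => simp
  | add a a' h h' => simp only [mul_add, map_add, h, h']; abel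
  | tmul p c =>
    simp only [s, kX, LinearMap.sum_apply, Algebra.TensorProduct.tmul_mul_tmul, one_mul,
      TensorProduct.map_tmul, LinearMap.mulLeft_apply, Finset.mul_sum, ← Finset.sum_neg_distrib]
    refine Finset.sum_congr rfl fun i _ => ?_
    rw [← mul_assoc, K.cX_anti, neg_mul, TensorProduct.tmul_neg, mul_assoc]

/-- The subalgebra `B ⊗ C` with `B` generated by the vectors and the group. -/
def base (_ : DiracDatum R C G ι) : Subalgebra ℂ (H ⊗[ℂ] C) :=
  (Algebra.TensorProduct.map (Algebra.adjoin ℂ (Set.range R.y ∪ Set.range R.g)).val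
    (AlgHom.id ℂ C)).range

theorem tmul_mem_base {p : H} (hp : p ∈ Algebra.adjoin ℂ (Set.range R.y ∪ Set.range R.g))
    (c : C) : p ⊗ₜ[ℂ] c ∈ K.base :=
  ⟨⟨p, hp⟩ ⊗ₜ c, by simp⟩

theorem s_base {a : H ⊗[ℂ] C} (ha : a ∈ K.base) : K.s a = 0 := by
  obtain ⟨a, rfl⟩ := ha
  induction a with
  | zero => simp
  | add a a' h h' =>
    simp only [AlgHom.toRingHom_eq_coe, RingHom.coe_coe, map_add] at h h' ⊢
    rw [h, h', add_zero]
  | tmul p c => simp [s, K.d_eq_zero _ _ p.2]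

theorem hY_mem (v : Y) : K.hY v ∈ K.base :=
  K.tmul_mem_base (Algebra.subset_adjoin (.inl ⟨v, rfl⟩)) _

theorem g_mem (w : W) : R.g w ∈ Algebra.adjoin ℂ (Set.range R.y ∪ Set.range R.g) :=
  Algebra.subset_adjoin (.inr ⟨w, rfl⟩)

/-- The commutator of a vector with a linear form involves only scalars and group elements, so no
linear form is left in the first factor. -/
theorem δ_hY_mem (v : Y) : K.δ (K.hY v) ∈ K.base := by
  rw [δ_apply, ε_hY]
  simp only [dirac, hY, Finset.sum_mul, Finset.mul_sum, Algebra.TensorProduct.tmul_mul_tmul,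
    mul_one, one_mul, ← Finset.sum_sub_distrib, ← TensorProduct.sub_tmul]
  refine sum_mem fun i _ => K.tmul_mem_base ?_ _
  rw [R.y_x, sub_add_cancel_left]
  exact neg_mem (add_mem (Subalgebra.smul_mem _ (one_mem _) _)
    (sum_mem fun s _ => Subalgebra.smul_mem _ (g_mem s) _))

/-- The Laplacian of the homotopy. -/
def L : Module.End ℂ (H ⊗[ℂ] C) := K.δ * K.s + K.s * K.δ

theorem L_apply (a : H ⊗[ℂ] C) : K.L a = K.δ (K.s a) + K.s (K.δ a) := rfl

/-- The cross terms `± kX v * δ a` cancel, leaving `δ (kX v) * a = -2 hX v * a`. Each linear form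
therefore lowers the eigenvalue of `L` by `2`. -/
theorem L_hX_mul (v : X) (a : H ⊗[ℂ] C) :
    K.L (K.hX v * a) = K.hX v * K.L a - (2 : ℂ) • (K.hX v * a) := by
  simp only [L_apply, s_hX_mul, δ_mul, map_add, δ_hX, δ_kX, ε_hX, ε_kX, zero_mul, zero_add,
    mul_add, neg_mul, neg_smul, smul_mul_assoc]
  abel

theorem L_kX_mul (v : X) (a : H ⊗[ℂ] C) :
    K.L (K.kX v * a) = K.kX v * K.L a - (2 : ℂ) • (K.kX v * a) := by
  simp only [L_apply, s_kX_mul, δ_mul, map_add, map_neg, map_smul, δ_kX, ε_kX, mul_add, neg_mul,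
    neg_smul, smul_mul_assoc, s_hX_mul, smul_add]
  abel

theorem δ_L (a : H ⊗[ℂ] C) : K.δ (K.L a) = K.L (K.δ a) := by
  simp [L_apply, δ_δ]

/-! ### Ordered products: eigenvalues, weights and spanning -/

/-- Products of `n` linear forms, then `d` vectors, then an element of the group, where linear
forms and vectors are taken in either factor. -/
inductive Homog : ℕ → ℕ → H ⊗[ℂ] C → Prop
  | Δ (q : G) : Homog 0 0 (K.Δ q)
  | hY {d a} (v : Y) : Homog 0 d a → Homog 0 (d + 1) (K.hY v * a)
  | kY {d a} (v : Y) : Homog 0 d a → Homog 0 (d + 1) (K.kY v * a)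
  | hX {n d a} (v : X) : Homog n d a → Homog (n + 1) d (K.hX v * a)
  | kX {n d a} (v : X) : Homog n d a → Homog (n + 1) d (K.kX v * a)

variable {K}

theorem Homog.mem_base {d : ℕ} {a : H ⊗[ℂ] C} (h : K.Homog 0 d a) :
    a ∈ K.base ∧ K.δ a ∈ K.base := by
  generalize hn : 0 = n at h
  induction h with
  | Δ q => exact ⟨K.tmul_mem_base (g_mem _) _, by rw [δ_Δ]; exact zero_mem _⟩
  | hY v _ ih =>
    refine ⟨mul_mem (K.hY_mem v) (ih rfl).1, ?_⟩
    rw [δ_mul, ε_hY]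
    exact add_mem (mul_mem (K.δ_hY_mem v) (ih rfl).1) (mul_mem (K.hY_mem v) (ih rfl).2)
  | kY v _ ih =>
    have : K.kY v ∈ K.base := K.tmul_mem_base (one_mem _) _
    refine ⟨mul_mem this (ih rfl).1, ?_⟩
    rw [δ_mul, ε_kY, δ_kY, zero_mul, zero_add]
    exact mul_mem (neg_mem this) (ih rfl).2
  | hX => cases hn
  | kX => cases hn

/-- For `n = 0` both the product and its image under `δ` lie in `base`, where `s` vanishes. The
linear forms are then added one at a time. -/
theorem Homog.L_eq {n d : ℕ} {a : H ⊗[ℂ] C} (h : K.Homog n d a) :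
    K.L a = (-2 * n : ℂ) • a := by
  have h0 {d a} (h : K.Homog 0 d a) : K.L a = (-2 * (0 : ℕ) : ℂ) • a := by
    rw [L_apply, K.s_base h.mem_base.1, K.s_base h.mem_base.2]; simp
  induction h with
  | Δ q => exact h0 (.Δ q)
  | hY v h => exact h0 (.hY v h)
  | kY v h => exact h0 (.kY v h)
  | hX v _ ih =>
    rw [L_hX_mul, ih, mul_smul_comm, ← sub_smul]; congr 1; push_cast; ring
  | kX v _ ih =>
    rw [L_kX_mul, ih, mul_smul_comm, ← sub_smul]; congr 1; push_cast; ring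

theorem Homog.σ_eq {n d : ℕ} {a : H ⊗[ℂ] C} (h : K.Homog n d a) (z : ℂˣ) :
    K.σ z a = ((z : ℂ) ^ ((d : ℤ) - n)) • a := by
  have hz : (z : ℂ) ≠ 0 := z.ne_zero
  induction h with
  | Δ q => simp [σ_Δ]
  | @hY d _ v _ ih | @kY d _ v _ ih =>
    rw [map_mul, ih]
    simp only [σ_hY, σ_kY, smul_mul_assoc, mul_smul_comm, smul_smul]
    congr 1
  | @hX n d _ v _ ih | @kX n d _ v _ ih =>
    rw [map_mul, ih]
    simp only [σ_hX, σ_kX, smul_mul_assoc, mul_smul_comm, smul_smul, Units.val_inv_eq_inv_val]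
    congr 1
    rw [← zpow_neg_one, ← zpow_add₀ hz]; congr 1; push_cast; ring

/-- The homotopy replaces a linear form in the first factor by the same form in the second, which
has the same weight. The data contain no equivariance of the `d i`, so this is checked on ordered
products. -/
theorem Homog.σ_s {n d : ℕ} {a : H ⊗[ℂ] C} (h : K.Homog n d a) (z : ℂˣ) :
    K.σ z (K.s a) = ((z : ℂ) ^ ((d : ℤ) - n)) • K.s a := by
  have hz : (z : ℂ) ≠ 0 := z.ne_zero
  have h0 {d a} (h : K.Homog 0 d a) : K.σ z (K.s a) = ((z : ℂ) ^ ((d : ℤ) - (0 : ℕ))) • K.s a := by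
    rw [K.s_base h.mem_base.1]; simp
  induction h with
  | Δ q => exact h0 (.Δ q)
  | hY v h => exact h0 (.hY v h)
  | kY v h => exact h0 (.kY v h)
  | @hX n d a v h ih =>
    have e : ((z : ℂ) ^ ((d : ℤ) - (n + 1 : ℕ))) = (↑z⁻¹ : ℂ) * (z : ℂ) ^ ((d : ℤ) - n) := by
      rw [Units.val_inv_eq_inv_val, ← zpow_neg_one, ← zpow_add₀ hz]; congr 1; push_cast; ring
    simp only [s_hX_mul, map_add, map_mul, ih, h.σ_eq z, σ_hX, σ_kX, e, mul_smul_comm,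
      smul_mul_assoc, smul_smul, smul_add]
    simp only [mul_comm]
  | @kX n d a v h ih =>
    have e : ((z : ℂ) ^ ((d : ℤ) - (n + 1 : ℕ))) = (↑z⁻¹ : ℂ) * (z : ℂ) ^ ((d : ℤ) - n) := by
      rw [Units.val_inv_eq_inv_val, ← zpow_neg_one, ← zpow_add₀ hz]; congr 1; push_cast; ring
    simp only [s_kX_mul, map_neg, map_mul, ih, σ_kX, e, mul_smul_comm,
      smul_mul_assoc, smul_smul, smul_neg]
    simp only [mul_comm]

variable (K)

/-- The span of the elements `Homog n d`. -/
def homogSpan : Submodule ℂ (H ⊗[ℂ] C) := Submodule.span ℂ {a | ∃ n d, K.Homog n d a}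

variable {K} in
theorem Homog.mem {n d : ℕ} {a : H ⊗[ℂ] C} (h : K.Homog n d a) : a ∈ K.homogSpan :=
  Submodule.subset_span ⟨n, d, h⟩

theorem mul_mem_homogSpan {m : H ⊗[ℂ] C}
    (hm : ∀ {n d a}, K.Homog n d a → m * a ∈ K.homogSpan) {a : H ⊗[ℂ] C}
    (ha : a ∈ K.homogSpan) : m * a ∈ K.homogSpan := by
  induction ha using Submodule.span_induction with
  | mem a ha => obtain ⟨n, d, h⟩ := ha; exact hm h
  | zero => rw [mul_zero]; exact zero_mem _
  | add a a' _ _ h h' => rw [mul_add]; exact add_mem h h'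
  | smul r a _ h => rw [mul_smul_comm]; exact Submodule.smul_mem _ _ h

theorem hX_mul_mem (v : X) {a : H ⊗[ℂ] C} (ha : a ∈ K.homogSpan) : K.hX v * a ∈ K.homogSpan :=
  K.mul_mem_homogSpan (fun h => (h.hX v).mem) ha

theorem kX_mul_mem (v : X) {a : H ⊗[ℂ] C} (ha : a ∈ K.homogSpan) : K.kX v * a ∈ K.homogSpan :=
  K.mul_mem_homogSpan (fun h => (h.kX v).mem) ha

theorem kY_kX (v : Y) (v' : X) :
    K.kY v * K.kX v' = -(K.kX v' * K.kY v) - (2 * K.P v' v) • 1 := by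
  simp [kY, kX, K.cY_cX, TensorProduct.tmul_sub, TensorProduct.tmul_neg,
    Algebra.TensorProduct.one_def]

/-- The vector is moved to the right past the linear forms. The Clifford relation creates only
shorter ordered products. -/
theorem kY_mul_mem (v : Y) {a : H ⊗[ℂ] C} (ha : a ∈ K.homogSpan) : K.kY v * a ∈ K.homogSpan := by
  refine K.mul_mem_homogSpan (fun h => ?_) ha
  induction h with
  | Δ q => exact (Homog.kY v (.Δ q)).mem
  | hY v' h _ => exact (Homog.kY v (.hY v' h)).mem
  | kY v' h _ => exact (Homog.kY v (.kY v' h)).mem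
  | hX v' h ih =>
    have : K.kY v * K.hX v' = K.hX v' * K.kY v := by simp [kY, hX]
    rw [← mul_assoc, this, mul_assoc]
    exact K.hX_mul_mem _ ih
  | kX v' h ih =>
    rw [← mul_assoc, kY_kX, sub_mul, neg_mul, mul_assoc, smul_mul_assoc, one_mul]
    exact sub_mem (neg_mem (K.kX_mul_mem _ ih)) (Submodule.smul_mem _ _ h.mem)

theorem Δ_mul_mem (q : G) {a : H ⊗[ℂ] C} (ha : a ∈ K.homogSpan) : K.Δ q * a ∈ K.homogSpan := by
  have key {n d a} (h : K.Homog n d a) : K.Homog n d (K.Δ q * a) := by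
    induction h with
    | Δ q' => rw [← map_mul]; exact .Δ _
    | hY v' h ih => rw [← mul_assoc, Δ_hY, mul_assoc]; exact .hY _ ih
    | kY v' h ih => rw [← mul_assoc, Δ_kY, mul_assoc]; exact .kY _ ih
    | hX v' h ih => rw [← mul_assoc, Δ_hX, mul_assoc]; exact .hX _ ih
    | kX v' h ih => rw [← mul_assoc, Δ_kX, mul_assoc]; exact .kX _ ih
  exact K.mul_mem_homogSpan (fun h => (key h).mem) ha

theorem one_tmul_mul_mem (c : C) {a : H ⊗[ℂ] C} (ha : a ∈ K.homogSpan) :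
    (1 : H) ⊗ₜ[ℂ] c * a ∈ K.homogSpan := by
  have hc : c ∈ Algebra.adjoin ℂ (Set.range K.cX ∪ Set.range K.cY) :=
    K.adjoin_C ▸ Algebra.mem_top
  induction hc using Algebra.adjoin_induction generalizing a with
  | mem c hc =>
    rcases hc with ⟨v, rfl⟩ | ⟨v, rfl⟩
    · exact K.kX_mul_mem v ha
    · exact K.kY_mul_mem v ha
  | algebraMap r =>
    rw [Algebra.algebraMap_eq_smul_one, TensorProduct.tmul_smul, smul_mul_assoc,
      ← Algebra.TensorProduct.one_def, one_mul]
    exact Submodule.smul_mem _ _ ha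
  | add c c' _ _ h h' => rw [TensorProduct.tmul_add, add_mul]; exact add_mem (h ha) (h' ha)
  | mul c c' _ _ h h' =>
    have : (1 : H) ⊗ₜ[ℂ] (c * c') = 1 ⊗ₜ c * 1 ⊗ₜ c' := by simp
    rw [this, mul_assoc]
    exact h (h' ha)

theorem hG_mul_mem (w : W) {a : H ⊗[ℂ] C} (ha : a ∈ K.homogSpan) : K.hG w * a ∈ K.homogSpan := by
  obtain ⟨q, rfl⟩ := K.π_surjective w
  -- Ordered products end in a diagonal element, so a group element of the first factor is traded
  -- for one at the cost of a Clifford element.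
  have : K.hG (K.π q) = 1 ⊗ₜ K.u q⁻¹ * K.Δ q := by
    simp [hG, Δ_apply, ← map_mul]
  rw [this, mul_assoc]
  exact K.one_tmul_mul_mem _ (K.Δ_mul_mem q ha)

theorem hY_mul_mem (v : Y) {a : H ⊗[ℂ] C} (ha : a ∈ K.homogSpan) : K.hY v * a ∈ K.homogSpan := by
  refine K.mul_mem_homogSpan (fun h => ?_) ha
  induction h with
  | Δ q => exact (Homog.hY v (.Δ q)).mem
  | hY v' h _ => exact (Homog.hY v (.hY v' h)).mem
  | kY v' h _ => exact (Homog.hY v (.kY v' h)).mem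
  | hX v' h ih =>
    have : K.hY v * K.hX v' = K.hX v' * K.hY v +
        (D.pair v v' • 1 + ∑ s, (D.θ s v * D.β s v') • K.hG s) := by
      simp [hY, hX, hG, R.y_x, TensorProduct.add_tmul, TensorProduct.sum_tmul,
        TensorProduct.smul_tmul', Algebra.TensorProduct.one_def]
    rw [← mul_assoc, this, add_mul, add_mul, mul_assoc, Finset.sum_mul, smul_mul_assoc, one_mul]
    refine add_mem (K.hX_mul_mem _ ih) (add_mem (Submodule.smul_mem _ _ h.mem)
      (sum_mem fun s _ => ?_))
    rw [smul_mul_assoc]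
    exact Submodule.smul_mem _ _ (K.hG_mul_mem _ h.mem)
  | kX v' h ih =>
    have : K.hY v * K.kX v' = K.kX v' * K.hY v := by simp [hY, kX]
    rw [← mul_assoc, this, mul_assoc]
    exact K.kX_mul_mem _ ih

theorem tmul_one_mul_mem (p : H) {a : H ⊗[ℂ] C} (ha : a ∈ K.homogSpan) :
    p ⊗ₜ[ℂ] (1 : C) * a ∈ K.homogSpan := by
  have hp : p ∈ Algebra.adjoin ℂ (Set.range R.x ∪ Set.range R.y ∪ Set.range R.g) :=
    K.adjoin_H ▸ Algebra.mem_top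
  induction hp using Algebra.adjoin_induction generalizing a with
  | mem p hp =>
    rcases hp with (⟨v, rfl⟩ | ⟨v, rfl⟩) | ⟨w, rfl⟩
    · exact K.hX_mul_mem v ha
    · exact K.hY_mul_mem v ha
    · exact K.hG_mul_mem w ha
  | algebraMap r =>
    rw [Algebra.algebraMap_eq_smul_one, ← TensorProduct.smul_tmul', smul_mul_assoc,
      ← Algebra.TensorProduct.one_def, one_mul]
    exact Submodule.smul_mem _ _ ha
  | add c c' _ _ h h' => rw [TensorProduct.add_tmul, add_mul]; exact add_mem (h ha) (h' ha)
  | mul c c' _ _ h h' =>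
    have : (c * c') ⊗ₜ[ℂ] (1 : C) = c ⊗ₜ 1 * c' ⊗ₜ 1 := by simp
    rw [this, mul_assoc]
    exact h (h' ha)

/-- The spanning half of a PBW statement: the span contains `Δ 1 = 1` and is stable under left
multiplication by all generators. -/
theorem homogSpan_eq_top : K.homogSpan = ⊤ := by
  refine eq_top_iff.2 fun a _ => ?_
  induction a with
  | zero => exact zero_mem _
  | add a a' h h' => exact add_mem (h trivial) (h' trivial)
  | tmul p c =>
    have : p ⊗ₜ[ℂ] c = p ⊗ₜ 1 * (1 ⊗ₜ c * K.Δ 1) := by simp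
    rw [this]
    exact K.tmul_one_mul_mem p (K.one_tmul_mul_mem c (Homog.Δ 1).mem)

end DiracDatum

end

section

variable {W X Y H : Type*} [Group W] [Fintype W] [AddCommGroup X] [Module ℂ X]
  [AddCommGroup Y] [Module ℂ Y] [Ring H] [Algebra ℂ H] {D : DunklDatum W X Y}

namespace DiracDatum

variable {R : D.Rep H} {C G ι : Type*} [Ring C] [Algebra ℂ C] [Group G] [Fintype ι]
  (K : DiracDatum R C G ι)

/-! #### The cohomology of the odd derivation -/

/-- The span of the elements `Homog n d` with `d - n = k`. -/
def weightSpan (k : ℤ) : Submodule ℂ (H ⊗[ℂ] C) :=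
  Submodule.span ℂ {a | ∃ n d, K.Homog n d a ∧ (d : ℤ) - n = k}

/-- The linear extension of the diagonal map. -/
def Δlin : MonoidAlgebra ℂ G →ₐ[ℂ] H ⊗[ℂ] C := MonoidAlgebra.lift ℂ (H ⊗[ℂ] C) G K.Δ

theorem Δlin_single (q : G) (r : ℂ) : K.Δlin (MonoidAlgebra.single q r) = r • K.Δ q := by
  simp [Δlin]

theorem Δlin_induction {S : Submodule ℂ (H ⊗[ℂ] C)} (h : ∀ q, K.Δ q ∈ S) (z : MonoidAlgebra ℂ G) :
    K.Δlin z ∈ S := by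
  induction z using MonoidAlgebra.induction_linear with
  | zero => rw [map_zero]; exact zero_mem _
  | add z z' h h' => rw [map_add]; exact add_mem h h'
  | single q r => rw [Δlin_single]; exact S.smul_mem _ (h q)

theorem Δlin_mem_ker {f : Module.End ℂ (H ⊗[ℂ] C)} (h : ∀ q, f (K.Δ q) = 0)
    (z : MonoidAlgebra ℂ G) : f (K.Δlin z) = 0 :=
  K.Δlin_induction (S := LinearMap.ker f) h z

theorem δ_Δlin (z : MonoidAlgebra ℂ G) : K.δ (K.Δlin z) = 0 := K.Δlin_mem_ker K.δ_Δ z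

theorem σ_Δlin (t : ℂˣ) (z : MonoidAlgebra ℂ G) : K.σ t (K.Δlin z) = K.Δlin z :=
  sub_eq_zero.1 <| K.Δlin_mem_ker (f := (K.σ t).toLinearMap - LinearMap.id)
    (fun q => by simp [σ_Δ]) z

theorem L_Δlin (z : MonoidAlgebra ℂ G) : K.L (K.Δlin z) = 0 :=
  K.Δlin_mem_ker (fun q => by simp [(Homog.Δ q).L_eq]) z

theorem iSup_weightSpan : ⨆ k, K.weightSpan k = ⊤ := by
  rw [← top_le_iff, ← K.homogSpan_eq_top]
  refine Submodule.span_le.2 ?_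
  rintro a ⟨n, d, h⟩
  exact Submodule.mem_iSup_of_mem ((d : ℤ) - n) (Submodule.subset_span ⟨n, d, h, rfl⟩)

/-- The single element `2` of `ℂˣ` separates the weights, since its integer powers are distinct.
Eigenspaces of its action are independent and contain the weight spans, which together fill the
space. -/
theorem mem_weightSpan_zero {a : H ⊗[ℂ] C} (ha : ∀ t, K.σ t a = a) : a ∈ K.weightSpan 0 := by
  have h2 : (2 : ℂ) ≠ 0 := two_ne_zero
  have hinj : Function.Injective fun k : ℤ => (2 : ℂ) ^ k := by
    intro k l hkl
    have : ((2 : ℝ) ^ k) = (2 : ℝ) ^ l := by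
      apply Complex.ofReal_injective
      simpa using hkl
    exact zpow_right_injective₀ (by norm_num) (by norm_num) this
  refine mem_of_iSupIndep (E := fun k : ℤ =>
      Module.End.eigenspace (K.σ (Units.mk0 2 h2)).toLinearMap ((2 : ℂ) ^ k))
    ((Module.End.eigenspaces_iSupIndep _).comp hinj) (fun k => Submodule.span_le.2 ?_)
    K.iSup_weightSpan ?_
  · rintro a ⟨n, d, h, rfl⟩
    exact Module.End.mem_eigenspace_iff.2 (h.σ_eq _)
  · rw [Module.End.mem_eigenspace_iff]
    simpa using ha _

/-- The span of the elements of weight zero with a positive number of linear forms. -/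
def posSpan : Submodule ℂ (H ⊗[ℂ] C) := Submodule.span ℂ {a | ∃ n, K.Homog (n + 1) (n + 1) a}

theorem σ_s_of_invariant {a : H ⊗[ℂ] C} (ha : a ∈ K.weightSpan 0) (t : ℂˣ) :
    K.σ t (K.s a) = K.s a := by
  rw [← sub_eq_zero]
  change a ∈ LinearMap.ker ((K.σ t).toLinearMap ∘ₗ K.s - K.s)
  refine (Submodule.span_le.2 ?_ : K.weightSpan 0 ≤ _) ha
  rintro a ⟨n, d, h, hnd⟩
  simp [h.σ_s t, hnd]

/-- Weight zero means as many vectors as linear forms, so a product without linear forms is a bare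
`Δ q`. -/
theorem exists_decomp {a : H ⊗[ℂ] C} (ha : ∀ t, K.σ t a = a) :
    ∃ z, ∃ p ∈ K.posSpan, a = K.Δlin z + p := by
  have h := K.mem_weightSpan_zero ha
  have : K.weightSpan 0 ≤ LinearMap.range K.Δlin.toLinearMap ⊔ K.posSpan := by
    refine Submodule.span_le.2 ?_
    rintro a ⟨n, d, h, hnd⟩
    obtain rfl : d = n := by omega
    cases d with
    | zero =>
      refine Submodule.mem_sup_left ?_
      cases h with
      | Δ q => exact ⟨MonoidAlgebra.single q 1, by simp [Δlin_single]⟩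
    | succ n => exact Submodule.mem_sup_right (Submodule.subset_span ⟨n, h⟩)
  obtain ⟨_, ⟨z, rfl⟩, p, hp, rfl⟩ := Submodule.mem_sup.1 (this h)
  exact ⟨z, p, hp, rfl⟩

theorem posSpan_le : K.posSpan ≤ K.weightSpan 0 := by
  refine Submodule.span_mono ?_
  rintro a ⟨n, h⟩
  exact ⟨_, _, h, sub_self _⟩

theorem exists_L_eq {p : H ⊗[ℂ] C} (hp : p ∈ K.posSpan) : ∃ p' ∈ K.posSpan, K.L p' = p := by
  change p ∈ K.posSpan.map K.L
  refine (Submodule.span_le.2 ?_ : K.posSpan ≤ _) hp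
  rintro a ⟨n, h⟩
  have hn : (-2 * (n + 1 : ℕ) : ℂ) ≠ 0 :=
    mul_ne_zero (by norm_num) (Nat.cast_ne_zero.2 n.succ_ne_zero)
  refine ⟨(-2 * (n + 1 : ℕ) : ℂ)⁻¹ • a, Submodule.smul_mem _ _ (Submodule.subset_span ⟨n, h⟩), ?_⟩
  rw [map_smul, h.L_eq, smul_smul, inv_mul_cancel₀ hn, one_smul]

/-- Since `δ` commutes with `L`, the element `δ p` is a sum of eigenvectors of `L` with nonzero
eigenvalues. Independence of eigenspaces excludes a nonzero such sum from the kernel of `L`. -/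
theorem eq_zero_of_L_δ {p : H ⊗[ℂ] C} (hp : p ∈ K.posSpan) (h : K.L (K.δ p) = 0) : K.δ p = 0 := by
  let E : ℂ → Submodule ℂ (H ⊗[ℂ] C) := Module.End.eigenspace K.L
  have hE : Disjoint (E 0) (⨆ (μ) (_ : μ ≠ 0), E μ) := Module.End.eigenspaces_iSupIndep K.L 0
  refine Submodule.disjoint_def.1 hE _ (by simpa [E, Module.End.mem_eigenspace_iff] using h) ?_
  change p ∈ (⨆ (μ) (_ : μ ≠ 0), E μ).comap K.δ
  refine (Submodule.span_le.2 ?_ : K.posSpan ≤ _) hp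
  rintro a ⟨n, h⟩
  have hn : (-2 * (n + 1 : ℕ) : ℂ) ≠ 0 :=
    mul_ne_zero (by norm_num) (Nat.cast_ne_zero.2 n.succ_ne_zero)
  refine Submodule.mem_iSup_of_mem _ (Submodule.mem_iSup_of_mem hn ?_)
  rw [Module.End.mem_eigenspace_iff, ← δ_L, h.L_eq, map_smul]

theorem exists_eq_δ_add {a : H ⊗[ℂ] C} (ha : ∀ t, K.σ t a = a) (hδ : K.δ a = 0) :
    ∃ a', (∀ t, K.σ t a' = a') ∧ ∃ z, a = K.δ a' + K.Δlin z := by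
  obtain ⟨z, p, hp, rfl⟩ := K.exists_decomp ha
  obtain ⟨p', hp', rfl⟩ := K.exists_L_eq hp
  -- Now `L (δ p') = 0`, hence `δ p' = 0`, and `L p'` reduces to `δ (s p')`.
  rw [map_add, δ_Δlin, zero_add, δ_L] at hδ
  refine ⟨K.s p', K.σ_s_of_invariant (K.posSpan_le hp'), z, ?_⟩
  rw [L_apply, K.eq_zero_of_L_δ hp' hδ, map_zero, add_zero, add_comm]

/-- The directness of the sum: `L` kills the image of `Δ`, while `δ a` comes from the part of `a`
with linear forms. -/
theorem δ_eq_zero {a : H ⊗[ℂ] C} (ha : ∀ t, K.σ t a = a) {z : MonoidAlgebra ℂ G}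
    (h : K.δ a = K.Δlin z) : K.δ a = 0 := by
  obtain ⟨z', p, hp, rfl⟩ := K.exists_decomp ha
  have h0 : K.L (K.δ (K.Δlin z' + p)) = 0 := by rw [h, L_Δlin]
  rw [map_add, δ_Δlin, zero_add] at h0 ⊢
  exact K.eq_zero_of_L_δ hp h0

/-! #### Invariants of the covering group -/

/-- The conjugation action on `H ⊗ C`. -/
def conj : G →* Module.End ℂ (H ⊗[ℂ] C) where
  toFun q := LinearMap.mulLeft ℂ (K.Δ q) ∘ₗ LinearMap.mulRight ℂ (K.Δ q⁻¹)
  map_one' := by ext; simp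
  map_mul' q q' := by
    refine LinearMap.ext fun a => ?_
    simp [mul_assoc]

theorem conj_apply (q : G) (a : H ⊗[ℂ] C) : K.conj q a = K.Δ q * a * K.Δ q⁻¹ := by
  simp [conj, mul_assoc]

/-- The conjugation action on the group algebra. -/
def conjAlg (_ : DiracDatum R C G ι) : G →* Module.End ℂ (MonoidAlgebra ℂ G) where
  toFun q := LinearMap.mulLeft ℂ (MonoidAlgebra.of ℂ G q) ∘ₗ
    LinearMap.mulRight ℂ (MonoidAlgebra.of ℂ G q⁻¹)
  map_one' := LinearMap.ext fun a => by simp [← MonoidAlgebra.one_def]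
  map_mul' q q' := by
    refine LinearMap.ext fun a => ?_
    simp only [mul_inv_rev, map_mul, LinearMap.comp_apply, LinearMap.mulLeft_apply,
      LinearMap.mulRight_apply, Module.End.mul_apply, mul_assoc]

theorem conjAlg_apply (q : G) (z : MonoidAlgebra ℂ G) :
    K.conjAlg q z = MonoidAlgebra.of ℂ G q * z * MonoidAlgebra.of ℂ G q⁻¹ := by
  simp only [conjAlg, MonoidHom.coe_mk, OneHom.coe_mk, LinearMap.comp_apply,
    LinearMap.mulLeft_apply, LinearMap.mulRight_apply, mul_assoc]

/-- An element over `1` commutes with the generators of `C` and is `1` in the first factor, so its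
diagonal image is central. -/
theorem conj_ker (k : G) (hk : K.π k = 1) : K.conj k = 1 := by
  have hc (c : C) : K.u k * c = c * K.u k := by
    have hc : c ∈ Algebra.adjoin ℂ (Set.range K.cX ∪ Set.range K.cY) :=
      K.adjoin_C ▸ Algebra.mem_top
    induction hc using Algebra.adjoin_induction with
    | mem c hc => rcases hc with ⟨v, rfl⟩ | ⟨v, rfl⟩ <;> simp [K.u_cX, K.u_cY, hk]
    | algebraMap r => exact (Algebra.commutes _ _).symm
    | add c c' _ _ h h' => rw [mul_add, add_mul, h, h']
    | mul c c' _ _ h h' => rw [← mul_assoc, h, mul_assoc, h', mul_assoc]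
  have hM (a : H ⊗[ℂ] C) : K.Δ k * a = a * K.Δ k := by
    induction a with
    | zero => simp
    | add a a' h h' => rw [mul_add, add_mul, h, h']
    | tmul p c => simp [Δ_apply, hk, hc]
  refine LinearMap.ext fun a => ?_
  rw [conj_apply, hM, mul_assoc, ← map_mul]
  simp

theorem conjAlg_ker (k : G) (hk : K.π k = 1) : K.conjAlg k = 1 := by
  refine LinearMap.ext fun z => ?_
  rw [conjAlg_apply]
  induction z using MonoidAlgebra.induction_linear with
  | zero => simp
  | add z z' h h' => rw [mul_add, add_mul, h, h', map_add]
  | single q r => simp [MonoidAlgebra.single_mul_single, K.ker_comm k hk q]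

theorem Δlin_conjAlg (q : G) (z : MonoidAlgebra ℂ G) :
    K.Δlin (K.conjAlg q z) = K.conj q (K.Δlin z) := by
  simp [conjAlg_apply, conj_apply, Δlin_single]

/-- The elements of weight zero that are invariant under the covering group. -/
def Inv (a : H ⊗[ℂ] C) : Prop := (∀ t, K.σ t a = a) ∧ ∀ q, K.conj q a = a

variable {K}

theorem Inv.δ {a : H ⊗[ℂ] C} (ha : K.Inv a) : K.Inv (K.δ a) := by
  refine ⟨fun t => by rw [σ_δ, ha.1], fun q => ?_⟩
  rw [conj_apply, ← δ_conj, ← conj_apply, ha.2]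

variable (K)

theorem inv_Δlin {z : MonoidAlgebra ℂ G} (hz : ∀ q, K.conjAlg q z = z) : K.Inv (K.Δlin z) :=
  ⟨fun t => K.σ_Δlin t z, fun q => by rw [← Δlin_conjAlg, hz]⟩

/-- Average a non-equivariant solution over `W`. Averaging commutes with `δ` and `Δ`, preserves
weight zero and fixes `a`. -/
theorem exists_eq_δ_add_of_inv {a : H ⊗[ℂ] C} (ha : K.Inv a) (hδ : K.δ a = 0) :
    ∃ a', K.Inv a' ∧ ∃ z, (∀ q, K.conjAlg q z = z) ∧ a = K.δ a' + K.Δlin z := by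
  obtain ⟨a', ha', z, h⟩ := K.exists_eq_δ_add ha.1 hδ
  choose l hl using K.π_surjective
  refine ⟨average K.conj l a', ⟨fun t => ?_, fun q => apply_average _ hl K.conj_ker q _⟩,
    average K.conjAlg l z, fun q => apply_average _ hl K.conjAlg_ker q _, ?_⟩
  · simp [average, LinearMap.sum_apply, conj_apply, σ_Δ, ha' t]
  · have h1 : average K.conj l (K.δ a') = K.δ (average K.conj l a') := by
      simp only [average, LinearMap.smul_apply, LinearMap.sum_apply, map_smul, map_sum, conj_apply,
        δ_conj]
    have h2 : average K.conj l (K.Δlin z) = K.Δlin (average K.conjAlg l z) := by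
      simp only [average, LinearMap.smul_apply, LinearMap.sum_apply, map_smul, map_sum,
        Δlin_conjAlg]
    rw [← h1, ← h2, ← map_add, ← h, average_eq_self _ _ ha.2]

end DiracDatum

end

/-! ### The Pin cover -/

section

open CliffordAlgebra

variable {h : Type*} [AddCommGroup h] [Module ℂ h]

theorem cliffordForm_apply (p : Module.Dual ℂ h × h) : cliffordForm h p = -2 * p.1 p.2 := by
  simp [cliffordForm]

theorem polar_cliffordForm (p q : Module.Dual ℂ h × h) :
    QuadraticMap.polar (cliffordForm h) p q = -2 * (p.1 q.2 + q.1 p.2) := by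
  simp [QuadraticMap.polar, cliffordForm_apply]
  ring

/-- Twisted conjugation by `a` is the orthogonal reflection in `a`. The normalisation `a² = -1`
makes it `p ↦ p + B(a, p) a`, with `B` the polar form. -/
theorem ι_mul_ι_of_eq_neg_one {a : Module.Dual ℂ h × h} (ha : cliffordForm h a = -1)
    (p : Module.Dual ℂ h × h) :
    ι (cliffordForm h) a * ι (cliffordForm h) p =
      -(ι (cliffordForm h) (p + QuadraticMap.polar (cliffordForm h) a p • a) *
        ι (cliffordForm h) a) := by
  have h1 := ι_mul_ι_add_swap (Q := cliffordForm h) a p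
  have h2 := ι_sq_scalar (cliffordForm h) a
  rw [ha, map_neg, map_one] at h2
  rw [map_add, map_smul, add_mul, smul_mul_assoc, h2, smul_neg, ← Algebra.algebraMap_eq_smul_one,
    ← h1]
  abel

theorem ι_mem_pinGroup {a : Module.Dual ℂ h × h} (ha : cliffordForm h a = -1) :
    ι (cliffordForm h) a ∈ pinGroup (cliffordForm h) := by
  have h2 := ι_sq_scalar (cliffordForm h) a
  rw [ha, map_neg, map_one] at h2
  let u : (Cliff h)ˣ := ⟨ι (cliffordForm h) a, -ι (cliffordForm h) a, by simp [h2], by simp [h2]⟩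
  refine (pinGroup.units_mem_iff (x := u)).2 ⟨Subgroup.subset_closure ⟨a, rfl⟩, ?_⟩
  rw [Unitary.mem_iff]
  simp [u, CliffordAlgebra.star_def, h2]

/-- The product of two unit vectors in the plane spanned by `f` and `v`, which scales `f` by `r²`
and `v` by `r⁻²` if `f v = 1`. -/
def torusElt (f : Module.Dual ℂ h) (v : h) (r : ℂ) : Cliff h :=
  ι (cliffordForm h) (r • f, (2 * r)⁻¹ • v) * ι (cliffordForm h) (f, (2 : ℂ)⁻¹ • v)

section

variable {f : Module.Dual ℂ h} {v : h} (hfv : f v = 1) {r : ℂ} (hr : r ≠ 0)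

include hfv hr

theorem torusElt_mem : torusElt f v r ∈ pinGroup (cliffordForm h) := by
  refine mul_mem (ι_mem_pinGroup ?_) (ι_mem_pinGroup ?_)
  · rw [cliffordForm_apply]; simp [hfv]; field_simp
  · rw [cliffordForm_apply]; simp [hfv]

/-- The composite of two reflections of the hyperbolic plane spanned by `f` and `v` preserves both
isotropic lines, scales them inversely and fixes the orthogonal complement. -/
theorem torusElt_mul_ι (p : Module.Dual ℂ h × h) :
    torusElt f v r * ι (cliffordForm h) p =
      ι (cliffordForm h) (p.1 + ((r ^ 2 - 1) * p.1 v) • f,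
        p.2 + (((r ^ 2)⁻¹ - 1) * f p.2) • v) * torusElt f v r := by
  rw [torusElt, mul_assoc, ι_mul_ι_of_eq_neg_one, mul_neg, ← mul_assoc, ι_mul_ι_of_eq_neg_one,
    neg_mul, neg_neg, mul_assoc]
  · congr 2
    simp only [polar_cliffordForm]
    refine Prod.ext ?_ ?_
    · simp only [Prod.fst_add, Prod.smul_fst, Prod.snd_add, Prod.smul_snd, map_add, map_smul,
        LinearMap.add_apply, LinearMap.smul_apply, smul_eq_mul, hfv]
      rw [smul_smul, add_assoc, ← add_smul]
      congr 2
      field_simp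
      ring
    · simp only [Prod.fst_add, Prod.smul_fst, Prod.snd_add, Prod.smul_snd, map_add, map_smul,
        LinearMap.add_apply, LinearMap.smul_apply, smul_eq_mul, hfv]
      rw [smul_smul, smul_smul, add_assoc, ← add_smul]
      congr 2
      field_simp
      ring
  · rw [cliffordForm_apply]; simp [hfv]; field_simp
  · rw [cliffordForm_apply]; simp [hfv]

theorem involute_torusElt : involute (torusElt f v r) = torusElt f v r := by
  simp [torusElt]

/-- As `f` and `v` square to zero in the Clifford algebra, only the mixed products survive, and
these have weight zero. -/
theorem cliffCstar_torusElt (z : ℂˣ) : cliffCstar z (torusElt f v r) = torusElt f v r := by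
  have key (f : Module.Dual ℂ h) (r s r' s' : ℂ) : ι (cliffordForm h) (r • f, s • v) *
      ι (cliffordForm h) (r' • f, s' • v) = (r * s') • (cliffX f * cliffY v) +
        (s * r') • (cliffY v * cliffX f) := by
    have e (r s : ℂ) : ι (cliffordForm h) (r • f, s • v) = r • cliffX f + s • cliffY v := by
      rw [cliffX, cliffY, ← map_smul, ← map_smul, ← map_add]; simp
    have hx : cliffX f * cliffX f = 0 := by
      rw [cliffX, ι_sq_scalar, cliffordForm_apply]; simp
    have hy : cliffY v * cliffY v = 0 := by
      rw [cliffY, ι_sq_scalar, cliffordForm_apply]; simp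
    rw [e, e]
    simp only [add_mul, mul_add, smul_mul_assoc, mul_smul_comm, hx, hy, smul_zero, zero_add,
      add_zero, smul_smul]
    rw [mul_comm r' s, add_comm]
    simp [mul_comm]
  have e1 := key f r (2 * r)⁻¹ 1 2⁻¹
  have e2 := key f (↑z⁻¹ * r) (z * (2 * r)⁻¹) ↑z⁻¹ (z * 2⁻¹)
  rw [one_smul] at e1
  have hz : (z : ℂ) ≠ 0 := z.ne_zero
  rw [torusElt, map_mul, cliffCstar, map_apply_ι, map_apply_ι]
  simp only [cstarIsometry]
  change ι (cliffordForm h) ((↑z⁻¹ : ℂ) • r • f, (z : ℂ) • (2 * r)⁻¹ • v) *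
    ι (cliffordForm h) ((↑z⁻¹ : ℂ) • f, (z : ℂ) • (2 : ℂ)⁻¹ • v) = _
  rw [smul_smul, smul_smul, smul_smul, e2, e1]
  congr 2 <;> (simp; try field_simp)

end

/-- The elements of the Clifford algebra acting trivially on vectors. -/
def TwistedCentral (u : Cliff h) : Prop :=
  ∀ p, involute u * ι (cliffordForm h) p = ι (cliffordForm h) p * u

/-- Passing a vector across `u` applies the parity automorphism to `u`; two vectors restore it. -/
theorem TwistedCentral.torusElt_comm {u : Cliff h} (hu : TwistedCentral u) (f : Module.Dual ℂ h)
    (v : h) (r : ℂ) : torusElt f v r * u = u * torusElt f v r := by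
  have h1 (p) : ι (cliffordForm h) p * involute u = u * ι (cliffordForm h) p := by
    have := congrArg involute (hu p)
    simp only [map_mul, involute_involute, involute_ι, mul_neg, neg_mul, neg_inj] at this
    exact this.symm
  rw [torusElt, mul_assoc, ← hu, ← mul_assoc, h1, mul_assoc]

/-- The `ℂˣ`-action is inner: multiply the torus elements of the planes of a basis and its dual,
with `r² = z⁻¹`. The factor `g'` records invertibility. -/
theorem exists_scaling {ι' : Type*} [Fintype ι'] (b : Module.Basis ι' ℂ h) (z : ℂˣ) :
    ∃ g g' : Cliff h, g * g' = 1 ∧ (∀ u, TwistedCentral u → g * u = u * g) ∧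
      ∀ a, g * a = cliffCstar z a * g := by
  classical
  obtain ⟨r, hr⟩ := IsAlgClosed.exists_pow_nat_eq (↑z⁻¹ : ℂ) (n := 2) two_pos
  have hr0 : r ≠ 0 := by
    rintro rfl
    exact (Units.ne_zero z⁻¹) (by rw [← hr]; simp)
  have hr2 : (r ^ 2)⁻¹ = (z : ℂ) := by rw [hr]; simp
  have main (F : Finset ι') : ∃ g g' : Cliff h, g * g' = 1 ∧
      (∀ u, TwistedCentral u → g * u = u * g) ∧ ∀ p, g * ι (cliffordForm h) p =
        ι (cliffordForm h) (p.1 + ∑ i ∈ F, (((↑z⁻¹ : ℂ) - 1) * p.1 (b i)) • b.coord i,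
          p.2 + ∑ i ∈ F, (((z : ℂ) - 1) * b.coord i p.2) • b i) * g := by
    induction F using Finset.induction_on with
    | empty => exact ⟨1, 1, by simp, by simp, by simp⟩
    | insert i F hi ih =>
      obtain ⟨g, g', hg, hu, hp⟩ := ih
      have hc : b.coord i (b i) = 1 := by simp
      refine ⟨torusElt (b.coord i) (b i) r * g, g' * star (torusElt (b.coord i) (b i) r), ?_,
        fun u hu' => ?_, fun p => ?_⟩
      · rw [mul_assoc, ← mul_assoc g, hg, one_mul,
          pinGroup.mul_star_self_of_mem (torusElt_mem hc hr0)]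
      · rw [mul_assoc, hu u hu', ← mul_assoc, hu'.torusElt_comm, mul_assoc]
      · rw [mul_assoc, hp, ← mul_assoc, torusElt_mul_ι hc hr0, mul_assoc]
        congr 2
        have hne : ∀ j ∈ F, j ≠ i := fun j hj e => hi (e ▸ hj)
        have e1 : ∑ j ∈ F, ((↑z⁻¹ : ℂ) - 1) * p.1 (b j) * b.coord j (b i) = 0 :=
          Finset.sum_eq_zero fun j hj => by simp [(hne j hj).symm]
        have e2 : ∑ j ∈ F, ((z : ℂ) - 1) * b.coord j p.2 * b.coord i (b j) = 0 :=
          Finset.sum_eq_zero fun j hj => by simp [hne j hj]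
        refine Prod.ext ?_ ?_
        · simp only [LinearMap.add_apply, LinearMap.sum_apply, LinearMap.smul_apply, smul_eq_mul,
            e1, add_zero, hr, Finset.sum_insert hi]
          abel
        · simp only [map_add, map_sum, map_smul, smul_eq_mul, e2, add_zero, hr2,
            Finset.sum_insert hi]
          abel
  obtain ⟨g, g', hg, hu, hp⟩ := main Finset.univ
  refine ⟨g, g', hg, hu, fun a => ?_⟩
  have hp' (p) : g * ι (cliffordForm h) p = cliffCstar z (ι (cliffordForm h) p) * g := by
    rw [hp, cliffCstar, map_apply_ι]
    congr 2
    have e1 : ∑ i, p.1 (b i) • b.coord i = p.1 := by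
      refine b.ext fun j => ?_
      simp
    have e2 : ∑ i, b.coord i p.2 • b i = p.2 := b.sum_repr p.2
    refine Prod.ext ?_ ?_
    · simp only [mul_smul, ← Finset.smul_sum, e1]
      change p.1 + _ = (↑z⁻¹ : ℂ) • p.1
      rw [sub_smul, one_smul, add_sub_cancel]
    · simp only [mul_smul, ← Finset.smul_sum, e2]
      change p.2 + _ = (z : ℂ) • p.2
      rw [sub_smul, one_smul, add_sub_cancel]
  induction a using CliffordAlgebra.induction with
  | algebraMap r => rw [AlgHom.commutes]; exact (Algebra.commutes _ _).symm
  | ι p => exact hp' p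
  | add a a' h h' => rw [mul_add, map_add, add_mul, h, h']
  | mul a a' h h' => rw [← mul_assoc, h, mul_assoc, h', map_mul, mul_assoc]

theorem involute_eq_cliffCstar : involute (Q := cliffordForm h) = cliffCstar (-1) := by
  refine CliffordAlgebra.hom_ext (LinearMap.ext fun p => ?_)
  simp only [LinearMap.comp_apply, AlgHom.toLinearMap_apply, involute_ι, cliffCstar, map_apply_ι]
  rw [← map_neg]
  congr 1
  refine Prod.ext ?_ ?_
  · change -p.1 = (↑(-1 : ℂˣ)⁻¹ : ℂ) • p.1
    simp
  · change -p.2 = (↑(-1 : ℂˣ) : ℂ) • p.2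
    simp

section

variable [FiniteDimensional ℂ h]

/-- The action of `z` is conjugation by an element that commutes with `u`. Evenness follows by
taking `z = -1`, which acts as the parity automorphism. -/
theorem TwistedCentral.cliffCstar_eq {u : Cliff h} (hu : TwistedCentral u) (z : ℂˣ) :
    cliffCstar z u = u := by
  obtain ⟨g, g', hg, hgu, hga⟩ := exists_scaling (Module.finBasis ℂ h) z
  have := hga u
  rw [hgu u hu] at this
  calc cliffCstar z u = cliffCstar z u * g * g' := by rw [mul_assoc, hg, mul_one]
    _ = u := by rw [← this, mul_assoc, hg, mul_one]

theorem TwistedCentral.involute_eq {u : Cliff h} (hu : TwistedCentral u) : involute u = u := by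
  rw [involute_eq_cliffCstar, hu.cliffCstar_eq]

end

end

/-! ### Pseudo-reflections -/

section

variable {h : Type*} [AddCommGroup h] [Module ℂ h] {W : Subgroup (h ≃ₗ[ℂ] h)}

theorem dualAct_apply_apply (w : h ≃ₗ[ℂ] h) (f : Module.Dual ℂ h) (v : h) :
    dualAct w f (w v) = f v := by
  simp [dualAct]

theorem eq_dualAct_of_apply {w : h ≃ₗ[ℂ] h} {f f' : Module.Dual ℂ h}
    (hf : ∀ v, f' (w v) = f v) : dualAct w f = f' := by
  refine LinearMap.ext fun v => ?_
  obtain ⟨v, rfl⟩ := w.surjective v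
  rw [dualAct_apply_apply, hf]

variable [FiniteDimensional ℂ h] [Finite W] (α : RootChoice W)

/-- The hyperplane fixed by `s` is the kernel of the root, so `s - 1` factors through the root; its
image is the line of the coroot. -/
theorem exists_reflection_formula {s : W} (hs : s ∈ pseudoReflections W) :
    ∃ k : ℂ, k ≠ 0 ∧ α.root s (α.coroot s) ≠ 0 ∧
      ∀ v, s.1 v = v + (k * α.root s v) • α.coroot s := by
  have hle : LinearMap.eqLocus ((s : h ≃ₗ[ℂ] h) : h →ₗ[ℂ] h) LinearMap.id ≤
      LinearMap.ker (α.root s) := fun v hv => α.root_apply_eq_zero s hs v hv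
  have hfin : Module.finrank ℂ (LinearMap.ker (α.root s)) + 1 = Module.finrank ℂ h :=
    Module.Dual.finrank_ker_add_one_of_ne_zero (α.root_ne_zero s hs)
  have hker := Submodule.eq_of_le_of_finrank_eq hle (by
    have : _ + 1 = _ := hs
    omega)
  have hfix (v : h) (hv : α.root s v = 0) : s.1 v = v := by
    have : v ∈ LinearMap.ker (α.root s) := hv
    rw [← hker] at this
    exact this
  obtain ⟨v₁, hv₁⟩ : ∃ v, α.root s v ≠ 0 := by
    by_contra! h0
    exact α.root_ne_zero s hs (LinearMap.ext h0)
  obtain ⟨v₀, hv₀⟩ : ∃ v, α.root s v = 1 :=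
    ⟨(α.root s v₁)⁻¹ • v₁, by simp [hv₁]⟩
  have hd (v : h) : s.1 v = v + α.root s v • (s.1 v₀ - v₀) := by
    have := hfix (v - α.root s v • v₀) (by simp [hv₀])
    rw [map_sub, map_smul, sub_eq_iff_eq_add] at this
    rw [this, smul_sub]
    abel
  -- Otherwise some functional kills this line but not the coroot. It would be fixed by `s`, and the
  -- coroot is annihilated by all such functionals.
  have hmem : α.coroot s ∈ Submodule.span ℂ {s.1 v₀ - v₀} := by
    by_contra hn
    obtain ⟨f, hf, hle⟩ := Submodule.exists_le_ker_of_notMem hn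
    refine hf (α.apply_coroot_eq_zero s hs f (eq_dualAct_of_apply fun v => ?_))
    have : f (s.1 v₀ - v₀) = 0 := hle (Submodule.mem_span_singleton_self _)
    rw [hd v, map_add, map_smul, this, smul_zero, add_zero]
  obtain ⟨μ, hμ⟩ := Submodule.mem_span_singleton.1 hmem
  have hμ0 : μ ≠ 0 := by
    rintro rfl
    exact α.coroot_ne_zero s hs (by rw [← hμ, zero_smul])
  have hform (v : h) : s.1 v = v + (μ⁻¹ * α.root s v) • α.coroot s := by
    rw [← hμ, smul_smul, mul_right_comm, inv_mul_cancel₀ hμ0, one_mul, ← hd]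
  refine ⟨μ⁻¹, inv_ne_zero hμ0, fun h0 => ?_, hform⟩
  -- If the root killed the coroot, `s` would be a transvection, of infinite order in characteristic
  -- zero.
  have hpow (m : ℕ) : (s.1 ^ m) v₀ = v₀ + (m * μ⁻¹) • α.coroot s := by
    induction m with
    | zero => simp
    | succ m ih =>
      rw [pow_succ', LinearEquiv.mul_apply, ih, map_add, map_smul, hform v₀, hform (α.coroot s), h0,
        hv₀]
      push_cast
      module
  have hord : (s ^ orderOf s : W) = 1 := pow_orderOf_eq_one s
  have := hpow (orderOf s)
  rw [← Subgroup.coe_pow, hord] at this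
  have h3 : ((orderOf s : ℂ) * μ⁻¹) • α.coroot s = 0 := by simpa using this
  rcases smul_eq_zero.1 h3 with h3 | h3
  · have : (orderOf s : ℂ) ≠ 0 := Nat.cast_ne_zero.2 (orderOf_pos s).ne'
    exact mul_ne_zero this (inv_ne_zero hμ0) h3
  · exact α.coroot_ne_zero s hs h3

/-- The scalar `k` such that `s v = v + k αₛ(v) αₛ^∨` for a pseudo-reflection `s`. -/
def reflCoeff (s : W) : ℂ :=
  open Classical in if hs : s ∈ pseudoReflections W then
    (exists_reflection_formula α hs).choose else 0

section

variable {α} {s : W} (hs : s ∈ pseudoReflections W)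

include hs

theorem reflCoeff_spec : reflCoeff α s ≠ 0 ∧ α.root s (α.coroot s) ≠ 0 ∧
      ∀ v, s.1 v = v + (reflCoeff α s * α.root s v) • α.coroot s := by
  rw [reflCoeff, dif_pos hs]
  exact (exists_reflection_formula α hs).choose_spec

/-- This scalar is the eigenvalue of the invertible map `s` on the coroot. -/
theorem one_add_reflCoeff_ne_zero : 1 + reflCoeff α s * α.root s (α.coroot s) ≠ 0 := by
  intro h0
  have : s.1 (α.coroot s) = (1 + reflCoeff α s * α.root s (α.coroot s)) • α.coroot s := by
    rw [(reflCoeff_spec (α := α) hs).2.2, add_smul, one_smul]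
  rw [h0, zero_smul] at this
  exact α.coroot_ne_zero s hs (s.1.map_eq_zero_iff.1 this)

theorem dualAct_reflection (f : Module.Dual ℂ h) :
    dualAct s.1 f = f + (-reflCoeff α s / (1 + reflCoeff α s * α.root s (α.coroot s)) *
      f (α.coroot s)) • α.root s := by
  have h1 := one_add_reflCoeff_ne_zero (α := α) hs
  refine eq_dualAct_of_apply fun v => ?_
  rw [(reflCoeff_spec (α := α) hs).2.2 v]
  simp only [LinearMap.add_apply, LinearMap.smul_apply, map_add, map_smul, smul_eq_mul]
  field_simp
  ring

omit hs [FiniteDimensional ℂ h] [Finite W] in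
theorem conj_apply_apply (w s : W) (v : h) : (w * s * w⁻¹).1 (w.1 v) = w.1 (s.1 v) := by
  change w.1 (s.1 (w.1.symm (w.1 v))) = _
  rw [LinearEquiv.symm_apply_apply]

omit [FiniteDimensional ℂ h] [Finite W] in
theorem conj_mem_pseudoReflections (w : W) : w * s * w⁻¹ ∈ pseudoReflections W := by
  have : LinearMap.eqLocus (((w * s * w⁻¹ : W) : h ≃ₗ[ℂ] h) : h →ₗ[ℂ] h) LinearMap.id =
      (LinearMap.eqLocus ((s : h ≃ₗ[ℂ] h) : h →ₗ[ℂ] h) LinearMap.id).map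
        (w.1 : h →ₗ[ℂ] h) := by
    ext v
    obtain ⟨v, rfl⟩ := w.1.surjective v
    have e := conj_apply_apply w s v
    constructor
    · intro hv
      exact ⟨v, w.1.injective (e.symm.trans hv), rfl⟩
    · rintro ⟨v', hv', e'⟩
      obtain rfl := w.1.injective e'
      exact e.trans (congrArg w.1 hv')
  change _ + 1 = _
  rw [this, LinearEquiv.finrank_map_eq]
  exact hs

/-- Roots and coroots of conjugate elements are chosen independently. The quotient ignores scalings,
and comparing the two formulas for `w s w⁻¹` on `w v` identifies the rank-one parts and the
eigenvalues. -/
theorem coeff_conj_eq (w : W) (v : h) (f : Module.Dual ℂ h) :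
    α.root (w * s * w⁻¹) (w.1 v) * dualAct w.1 f (α.coroot (w * s * w⁻¹)) /
        α.root (w * s * w⁻¹) (α.coroot (w * s * w⁻¹)) =
      α.root s v * f (α.coroot s) / α.root s (α.coroot s) := by
  obtain ⟨hk, hr, hf⟩ := reflCoeff_spec (α := α) hs
  obtain ⟨hk', hr', hf'⟩ := reflCoeff_spec (α := α) (conj_mem_pseudoReflections hs w)
  set s' := w * s * w⁻¹
  set k := reflCoeff α s
  set k' := reflCoeff α s'
  have key (v : h) : (k' * α.root s' (w.1 v)) • α.coroot s' =
      (k * α.root s v) • w.1 (α.coroot s) := by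
    have h1 : s'.1 (w.1 v) = w.1 (s.1 v) := conj_apply_apply w s v
    rw [hf', hf, map_add, map_smul] at h1
    exact add_left_cancel h1
  have h1 := congrArg (α.root s') (key (α.coroot s))
  have h2 : α.root s' (w.1 (α.coroot s)) ≠ 0 := by
    intro h0
    have := key (α.coroot s)
    rw [h0, mul_zero, zero_smul, eq_comm, smul_eq_zero] at this
    rcases this with h3 | h3
    · exact mul_ne_zero hk hr h3
    · exact α.coroot_ne_zero s hs (w.1.map_eq_zero_iff.1 h3)
  have h3 : k' * α.root s' (α.coroot s') = k * α.root s (α.coroot s) := by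
    apply mul_right_cancel₀ h2
    simp only [map_smul, smul_eq_mul] at h1
    linear_combination h1
  have h4 := congrArg (dualAct w.1 f) (key v)
  simp only [map_smul, smul_eq_mul, dualAct_apply_apply] at h4
  rw [div_eq_div_iff hr' hr]
  apply mul_left_cancel₀ (mul_ne_zero hk hk')
  linear_combination (k * α.root s (α.coroot s)) * h4 - k * α.root s v * f (α.coroot s) * h3

end

end

/-! ### The double cover of a reflection group -/

section

open CliffordAlgebra

variable {h : Type*} [AddCommGroup h] [Module ℂ h] {W : Subgroup (h ≃ₗ[ℂ] h)}

theorem pin_coe_mul_inv (u : pinGroup (cliffordForm h)) :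
    (u : Cliff h) * ((u⁻¹ : pinGroup (cliffordForm h)) : Cliff h) = 1 := by
  rw [← Submonoid.coe_mul, mul_inv_cancel, Submonoid.coe_one]

theorem pin_coe_inv_mul (u : pinGroup (cliffordForm h)) :
    ((u⁻¹ : pinGroup (cliffordForm h)) : Cliff h) * (u : Cliff h) = 1 := by
  rw [← Submonoid.coe_mul, inv_mul_cancel, Submonoid.coe_one]

theorem involute_mul_ι_of_mem_pinCover {q : pinGroup (cliffordForm h) × W} (hq : q ∈ pinCover W)
    (p : Module.Dual ℂ h × h) :
    involute (q.1 : Cliff h) * ι (cliffordForm h) p =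
      ι (cliffordForm h) (actV q.2.1 p) * (q.1 : Cliff h) := by
  rw [← hq p, mul_assoc, pin_coe_inv_mul, mul_one]

theorem mem_pinCover_of_mul_ι {q : pinGroup (cliffordForm h) × W}
    (hq : ∀ p, involute (q.1 : Cliff h) * ι (cliffordForm h) p =
      ι (cliffordForm h) (actV q.2.1 p) * (q.1 : Cliff h)) : q ∈ pinCover W := by
  intro p
  rw [hq, mul_assoc, pin_coe_mul_inv, mul_one]

theorem actV_one (p : Module.Dual ℂ h × h) : actV 1 p = p :=
  Prod.ext (by ext; simp [actV, dualAct]) rfl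

theorem twistedCentral_of_mem_pinCover {q : pinGroup (cliffordForm h) × W} (hq : q ∈ pinCover W)
    (h1 : q.2 = 1) : TwistedCentral (q.1 : Cliff h) := by
  intro p
  rw [involute_mul_ι_of_mem_pinCover hq, h1, Subgroup.coe_one, actV_one]

/-- An element that is even and fixed by the action of `ℂˣ`. -/
def EvenInv (u : Cliff h) : Prop := involute u = u ∧ ∀ z, cliffCstar z u = u

theorem EvenInv.mul {u u' : Cliff h} (hu : EvenInv u) (hu' : EvenInv u') : EvenInv (u * u') :=
  ⟨by rw [map_mul, hu.1, hu'.1], fun z => by rw [map_mul, hu.2, hu'.2]⟩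

theorem EvenInv.inv {u : pinGroup (cliffordForm h)} (hu : EvenInv (u : Cliff h)) :
    EvenInv ((u⁻¹ : pinGroup (cliffordForm h)) : Cliff h) := by
  have key (f : Cliff h →ₐ[ℂ] Cliff h) (hf : f u = u) :
      f ((u⁻¹ : pinGroup (cliffordForm h)) : Cliff h) =
        ((u⁻¹ : pinGroup (cliffordForm h)) : Cliff h) := by
    calc f ((u⁻¹ : pinGroup (cliffordForm h)) : Cliff h)
        = f ((u⁻¹ : pinGroup (cliffordForm h)) : Cliff h) *
            ((u : Cliff h) * ((u⁻¹ : pinGroup (cliffordForm h)) : Cliff h)) := by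
          rw [pin_coe_mul_inv, mul_one]
      _ = f (((u⁻¹ : pinGroup (cliffordForm h)) : Cliff h) * u) *
            ((u⁻¹ : pinGroup (cliffordForm h)) : Cliff h) := by rw [map_mul, hf, mul_assoc]
      _ = _ := by rw [pin_coe_inv_mul, map_one, one_mul]
  exact ⟨key _ hu.1, fun z => key _ (hu.2 z)⟩

variable [FiniteDimensional ℂ h] [Finite W] (α : RootChoice W)

include α

theorem exists_lift_reflection {s : W} (hs : s ∈ pseudoReflections W) :
    ∃ u : pinGroup (cliffordForm h), (u, s) ∈ pinCover W ∧ EvenInv (u : Cliff h) := by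
  obtain ⟨hk, hr, hf⟩ := reflCoeff_spec (α := α) hs
  have h1 := one_add_reflCoeff_ne_zero (α := α) hs
  have hd := dualAct_reflection (α := α) hs
  set k := reflCoeff α s
  set a := α.root s
  set v := α.coroot s
  -- The torus element scales the coroot by `r⁻²`, which must be the eigenvalue `1 + k * a v` of
  -- `s`.
  obtain ⟨r, hr2⟩ := IsAlgClosed.exists_pow_nat_eq (1 + k * a v)⁻¹ (n := 2) two_pos
  have hr0 : r ≠ 0 := by
    rintro rfl
    exact inv_ne_zero h1 (by rw [← hr2]; simp)
  have hfv : ((a v)⁻¹ • a) v = 1 := by simp [hr]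
  refine ⟨⟨torusElt ((a v)⁻¹ • a) v r, torusElt_mem hfv hr0⟩, mem_pinCover_of_mul_ι fun p => ?_,
    involute_torusElt hfv hr0, cliffCstar_torusElt hfv hr0⟩
  simp only [involute_torusElt hfv hr0, torusElt_mul_ι hfv hr0]
  congr 2
  refine Prod.ext ?_ ?_
  · change _ = dualAct s.1 p.1
    rw [hd, hr2, smul_smul]
    refine congrArg (fun z => p.1 + z • a) ?_
    field_simp
    ring
  · change _ = s.1 p.2
    rw [hf, hr2, inv_inv]
    refine congrArg (fun z => p.2 + z • v) ?_
    simp only [LinearMap.smul_apply, smul_eq_mul]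
    field_simp
    ring

variable (hW : Subgroup.closure (pseudoReflections W) = ⊤)

include hW

theorem exists_lift (w : W) :
    ∃ u : pinGroup (cliffordForm h), (u, w) ∈ pinCover W ∧ EvenInv (u : Cliff h) := by
  have hw : w ∈ Subgroup.closure (pseudoReflections W) := hW ▸ Subgroup.mem_top w
  induction hw using Subgroup.closure_induction with
  | mem s hs => exact exists_lift_reflection α hs
  | one => exact ⟨1, one_mem _, by simp [EvenInv]⟩
  | mul w w' _ _ ih ih' =>
    obtain ⟨u, hu, hu1⟩ := ih
    obtain ⟨u', hu', hu1'⟩ := ih'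
    exact ⟨u * u', mul_mem hu hu', hu1.mul hu1'⟩
  | inv w _ ih =>
    obtain ⟨u, hu, hu1⟩ := ih
    exact ⟨u⁻¹, inv_mem hu, hu1.inv⟩

/-- Divide by a lift built from torus elements: the quotient lies over `1`, so it is twisted central
and hence even and invariant. -/
theorem evenInv_of_mem_pinCover {q : pinGroup (cliffordForm h) × W} (hq : q ∈ pinCover W) :
    EvenInv (q.1 : Cliff h) := by
  obtain ⟨u, hu, hu1⟩ := exists_lift α hW q.2
  have hk := twistedCentral_of_mem_pinCover (mul_mem hq (inv_mem hu)) (by simp)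
  have := EvenInv.mul ⟨hk.involute_eq, hk.cliffCstar_eq⟩ hu1
  simpa [mul_assoc, pin_coe_inv_mul] using this

theorem mul_ι_of_mem_pinCover {q : pinGroup (cliffordForm h) × W} (hq : q ∈ pinCover W)
    (p : Module.Dual ℂ h × h) :
    (q.1 : Cliff h) * ι (cliffordForm h) p =
      ι (cliffordForm h) (actV q.2.1 p) * (q.1 : Cliff h) := by
  rw [← involute_mul_ι_of_mem_pinCover hq, (evenInv_of_mem_pinCover α hW hq).1]

/-- By evenness, twisted commutation with vectors is ordinary commutation, so `k` is central in the
Clifford algebra. -/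
theorem pinCover_ker_comm (k : pinCover W) (hk : k.1.2 = 1) (q : pinCover W) :
    k * q = q * k := by
  have hc (c : Cliff h) : (k.1.1 : Cliff h) * c = c * k.1.1 := by
    induction c using CliffordAlgebra.induction with
    | algebraMap r => exact (Algebra.commutes _ _).symm
    | ι p => rw [mul_ι_of_mem_pinCover α hW k.2, hk, Subgroup.coe_one, actV_one]
    | add a a' h h' => rw [mul_add, add_mul, h, h']
    | mul a a' h h' => rw [← mul_assoc, h, mul_assoc, h', mul_assoc]
  refine Subtype.ext (Prod.ext (Subtype.ext (hc _)) ?_)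
  simp [hk]

end

/-! ### The universal property of the Cherednik algebra -/

section

variable {h : Type*} [AddCommGroup h] [Module ℂ h] {W : Subgroup (h ≃ₗ[ℂ] h)}

/-- The coefficient of the pseudo-reflection `s` in `[v, f]`. -/
def commCoeff (α : RootChoice W) (c : W → ℂ) (s : W) (v : h) (f : Module.Dual ℂ h) : ℂ :=
  open Classical in if s ∈ pseudoReflections W then
    -(c s * (α.root s v * f (α.coroot s) / α.root s (α.coroot s))) else 0

theorem rhs_eq_sum [Fintype W] {E : Type*} [Ring E] [Algebra ℂ E] (α : RootChoice W) (c : W → ℂ)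
    (F : FreeAlgebra ℂ (Gen W) →ₐ[ℂ] E) (r : ℂ) (v : h) (f : Module.Dual ℂ h) :
    F (algebraMap ℂ _ r - ∑ᶠ s ∈ pseudoReflections W,
      (c s * (α.root s v * f (α.coroot s) / α.root s (α.coroot s))) • gen (.g s)) =
    r • 1 + ∑ s, commCoeff α c s v f • F (gen (.g s)) := by
  classical
  rw [finsum_mem_def, finsum_eq_sum_of_fintype, map_sub, AlgHom.commutes, map_sum,
    Algebra.algebraMap_eq_smul_one, sub_eq_add_neg, ← Finset.sum_neg_distrib]
  congr 1
  refine Finset.sum_congr rfl fun s _ => ?_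
  by_cases hs : s ∈ pseudoReflections W <;> simp [commCoeff, hs]

namespace Cherednik

variable (α : RootChoice W) (t : ℂ) (c : W → ℂ)

/-- `Cherednik.x` as a linear map. -/
def xLin : Module.Dual ℂ h →ₗ[ℂ] Cherednik α t c where
  toFun := Cherednik.x α t c
  map_add' f f' := by rw [x, mk_eq (.x_add f f'), map_add]; rfl
  map_smul' r f := by rw [x, mk_eq (.x_smul r f), map_smul]; rfl

/-- `Cherednik.y` as a linear map. -/
def yLin : h →ₗ[ℂ] Cherednik α t c where
  toFun := Cherednik.y α t c
  map_add' f f' := by rw [y, mk_eq (.y_add f f'), map_add]; rfl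
  map_smul' r f := by rw [y, mk_eq (.y_smul r f), map_smul]; rfl

theorem yLin_mul_xLin [Fintype W] (v : h) (f : Module.Dual ℂ h) :
    yLin α t c v * xLin α t c f - xLin α t c f * yLin α t c v =
      (t * f v) • 1 + ∑ s, commCoeff α c s v f • ofGroup α t c s := by
  have := mk_eq (Rel.y_x (α := α) (t := t) (c := c) v f)
  rw [rhs_eq_sum, map_sub, map_mul, map_mul] at this
  exact this

theorem adjoin_eq_top :
    Algebra.adjoin ℂ (Set.range (xLin α t c) ∪ Set.range (yLin α t c) ∪
      Set.range (ofGroup α t c)) = ⊤ := by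
  refine eq_top_iff.2 fun a _ => ?_
  obtain ⟨a, rfl⟩ := RingQuot.mkAlgHom_surjective ℂ (Rel α t c) a
  change mk α t c a ∈ _
  induction a using FreeAlgebra.induction with
  | grade0 r => rw [AlgHom.commutes]; exact algebraMap_mem _ _
  | grade1 a =>
    refine Algebra.subset_adjoin ?_
    cases a with
    | x f => exact .inl (.inl ⟨f, rfl⟩)
    | y v => exact .inl (.inr ⟨v, rfl⟩)
    | g w => exact .inr ⟨w, rfl⟩
  | mul a b ha hb => rw [map_mul]; exact mul_mem (ha trivial) (hb trivial)
  | add a b ha hb => rw [map_add]; exact add_mem (ha trivial) (hb trivial)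

theorem exists_lift [Fintype W] {E : Type*} [Ring E] [Algebra ℂ E]
    (xE : Module.Dual ℂ h →ₗ[ℂ] E) (yE : h →ₗ[ℂ] E) (gE : W →* E)
    (g_x : ∀ w f, gE w * xE f = xE (dualAct w.1 f) * gE w)
    (g_y : ∀ w v, gE w * yE v = yE (w.1 v) * gE w)
    (x_comm : ∀ f f', xE f * xE f' = xE f' * xE f)
    (y_comm : ∀ v v', yE v * yE v' = yE v' * yE v)
    (y_x : ∀ v f, yE v * xE f - xE f * yE v =
      (t * f v) • 1 + ∑ s, commCoeff α c s v f • gE s) :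
    ∃ Ψ : Cherednik α t c →ₐ[ℂ] E, (∀ f, Ψ (xLin α t c f) = xE f) ∧
      (∀ v, Ψ (yLin α t c v) = yE v) ∧ ∀ w, Ψ (ofGroup α t c w) = gE w := by
  let G : Gen W → E
    | .x f => xE f
    | .y v => yE v
    | .g w => gE w
  have key (a : Gen W) : FreeAlgebra.lift ℂ G (gen a) = G a := FreeAlgebra.lift_ι_apply _ _
  have hrel : ∀ a b, Rel α t c a b → FreeAlgebra.lift ℂ G a = FreeAlgebra.lift ℂ G b := by
    intro a b hab
    cases hab with
    | x_add f f' => simp [key, G]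
    | x_smul r f => simp [key, G]
    | y_add v v' => simp [key, G]
    | y_smul r v => simp [key, G]
    | g_one => simp [key, G]
    | g_mul w w' => simp [key, G]
    | g_x w f => simp only [map_mul, key, G, g_x]
    | g_y w v => simp only [map_mul, key, G, g_y]
    | x_comm f f' => simp only [map_mul, key, G, x_comm f f']
    | y_comm v v' => simp only [map_mul, key, G, y_comm v v']
    | y_x v f => rw [rhs_eq_sum]; simp only [map_sub, map_mul, key, G, y_x]
  have hΨ (a) : RingQuot.liftAlgHom ℂ ⟨FreeAlgebra.lift ℂ G, fun _ _ hab => hrel _ _ hab⟩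
      (RingQuot.mkAlgHom ℂ (Rel α t c) (gen a)) = G a := by
    rw [RingQuot.liftAlgHom_mkAlgHom_apply, key]
  exact ⟨RingQuot.liftAlgHom ℂ ⟨FreeAlgebra.lift ℂ G, fun _ _ hab => hrel _ _ hab⟩,
    fun f => hΨ (.x f), fun v => hΨ (.y v), fun w => hΨ (.g w)⟩

theorem cstar_gen (z : ℂˣ) (a : Gen W) :
    cstar α t c z (mk α t c (gen a)) = cstarGen α t c z a := by
  change RingQuot.liftAlgHom ℂ _ (RingQuot.mkAlgHom ℂ (Rel α t c) (gen a)) = _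
  rw [RingQuot.liftAlgHom_mkAlgHom_apply]
  exact FreeAlgebra.lift_ι_apply _ _

end Cherednik

end

/-! ### The two half-Dirac operators -/

section

variable {h : Type*} [AddCommGroup h] [Module ℂ h] {W : Subgroup (h ≃ₗ[ℂ] h)}

variable (W) in
/-- The representation of `W` on `h`. -/
def actLin : W →* Module.End ℂ h where
  toFun w := w.1
  map_one' := rfl
  map_mul' _ _ := rfl

variable (W) in
/-- The representation of `W` on the dual of `h`. -/
def dualActLin : W →* Module.End ℂ (Module.Dual ℂ h) where
  toFun w := ⟨⟨dualAct w.1, fun _ _ => rfl⟩, fun _ _ => rfl⟩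
  map_one' := LinearMap.ext fun f => congrArg Prod.fst (actV_one (f, (0 : h)))
  map_mul' w w' := LinearMap.ext fun f => congrArg Prod.fst (actV_mul w.1 w'.1 (f, (0 : h)))

variable [FiniteDimensional ℂ h] [Finite W] (α : RootChoice W) (t : ℂ) (c : W → ℂ)

theorem commCoeff_conj
    (hc : ∀ w : W, ∀ s ∈ pseudoReflections W, c (w * s * w⁻¹) = c s) (w s : W) (v : h)
    (f : Module.Dual ℂ h) :
    commCoeff α c (w * s * w⁻¹) (w.1 v) (dualAct w.1 f) = commCoeff α c s v f := by
  by_cases hs : s ∈ pseudoReflections W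
  · rw [commCoeff, commCoeff, if_pos hs, if_pos (conj_mem_pseudoReflections hs w), hc w s hs,
      coeff_conj_eq hs]
  · have hs' : w * s * w⁻¹ ∉ pseudoReflections W := fun h' => hs (by
      have := conj_mem_pseudoReflections h' w⁻¹
      simpa [mul_assoc] using this)
    rw [commCoeff, commCoeff, if_neg hs, if_neg hs']

/-- The linear form `v ↦ -c(s) αₛ(v) / αₛ(αₛ^∨)`. -/
def formX (s : W) : h →ₗ[ℂ] ℂ :=
  open Classical in if s ∈ pseudoReflections W then
    (-(c s / α.root s (α.coroot s))) • α.root s else 0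

/-- The linear form `f ↦ c(s) f(αₛ^∨) / αₛ(αₛ^∨)`. -/
def formY (s : W) : Module.Dual ℂ h →ₗ[ℂ] ℂ :=
  open Classical in if s ∈ pseudoReflections W then
    (c s / α.root s (α.coroot s)) • Module.Dual.eval ℂ h (α.coroot s) else 0

theorem formX_mul (s : W) (v : h) (f : Module.Dual ℂ h) :
    formX α c s v * f (α.coroot s) = commCoeff α c s v f := by
  by_cases hs : s ∈ pseudoReflections W
  · simp [formX, commCoeff, hs]; ring
  · simp [formX, commCoeff, hs]

theorem formY_mul (s : W) (v : h) (f : Module.Dual ℂ h) :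
    formY α c s f * α.root s v = -commCoeff α c s v f := by
  by_cases hs : s ∈ pseudoReflections W
  · simp [formY, commCoeff, hs]; ring
  · simp [formY, commCoeff, hs]

theorem mem_of_formX {s : W} (hs : formX α c s ≠ 0) : s ∈ pseudoReflections W := by
  by_contra h'; exact hs (by rw [formX, if_neg h'])

theorem mem_of_formY {s : W} (hs : formY α c s ≠ 0) : s ∈ pseudoReflections W := by
  by_contra h'; exact hs (by rw [formY, if_neg h'])

variable (hc : ∀ w : W, ∀ s ∈ pseudoReflections W, c (w * s * w⁻¹) = c s)

/-- The commutation relations of the Cherednik algebra. -/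
def datumX : DunklDatum W (Module.Dual ℂ h) h where
  actX := dualActLin W
  actY := actLin W
  pair := t • Module.Dual.eval ℂ h
  θ := formX α c
  β s := Module.Dual.eval ℂ h (α.coroot s)
  a s := (-reflCoeff α s / (1 + reflCoeff α s * α.root s (α.coroot s))) • α.root s
  pair_act w v f := congrArg (t * ·) (dualAct_apply_apply w.1 f v)
  coeff_conj w s v f := by
    change formX α c (w * s * w⁻¹) (w.1 v) * (dualAct w.1 f) (α.coroot (w * s * w⁻¹)) =
      formX α c s v * f (α.coroot s)
    rw [formX_mul, formX_mul, commCoeff_conj α c hc]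
  a_ne_zero s hs := by
    have hs := mem_of_formX α c hs
    exact smul_ne_zero (div_ne_zero (neg_ne_zero.2 (reflCoeff_spec hs).1)
      (one_add_reflCoeff_ne_zero hs)) (α.root_ne_zero s hs)
  actX_sub s hs f := by
    have hs := mem_of_formX α c hs
    change dualAct s.1 f - f = f (α.coroot s) • _
    rw [dualAct_reflection (α := α) hs, add_sub_cancel_left, smul_smul, mul_comm]
  θ_symm s v v' := by
    by_cases hs : s ∈ pseudoReflections W
    · change _ • (s.1 v' - v') = _ • (s.1 v - v)
      rw [(reflCoeff_spec (α := α) hs).2.2 v, (reflCoeff_spec (α := α) hs).2.2 v',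
        add_sub_cancel_left, add_sub_cancel_left, smul_smul, smul_smul, formX, if_pos hs]
      congr 1
      simp only [LinearMap.smul_apply, smul_eq_mul]
      ring
    · rw [formX, if_neg hs]; simp

/-- The commutation relations of the Cherednik algebra, with the roles of `h` and its dual
exchanged. -/
def datumY : DunklDatum W h (Module.Dual ℂ h) where
  actX := actLin W
  actY := dualActLin W
  -- The sign comes from `[x, y] = -[y, x]`; `formY` absorbs the same sign in the reflection terms.
  pair := (-t) • LinearMap.id
  θ := formY α c
  β s := α.root s
  a s := reflCoeff α s • α.coroot s
  pair_act w f v := congrArg (-t * ·) (dualAct_apply_apply w.1 f v)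
  coeff_conj w s f v := by
    change formY α c (w * s * w⁻¹) (dualAct w.1 f) * α.root (w * s * w⁻¹) (w.1 v) =
      formY α c s f * α.root s v
    rw [formY_mul, formY_mul, commCoeff_conj α c hc]
  a_ne_zero s hs := by
    have hs := mem_of_formY α c hs
    exact smul_ne_zero (reflCoeff_spec hs).1 (α.coroot_ne_zero s hs)
  actX_sub s hs v := by
    have hs := mem_of_formY α c hs
    change s.1 v - v = α.root s v • _
    rw [(reflCoeff_spec (α := α) hs).2.2 v, add_sub_cancel_left, smul_smul, mul_comm]
  θ_symm s f f' := by
    by_cases hs : s ∈ pseudoReflections W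
    · change _ • (dualAct s.1 f' - f') = _ • (dualAct s.1 f - f)
      rw [dualAct_reflection (α := α) hs, dualAct_reflection (α := α) hs,
        add_sub_cancel_left, add_sub_cancel_left, smul_smul, smul_smul, formY, if_pos hs]
      congr 1
      simp only [LinearMap.smul_apply, smul_eq_mul, Module.Dual.eval_apply]
      ring
    · rw [formY, if_neg hs]; simp

theorem Cherednik.g_mul_x (w : W) (f : Module.Dual ℂ h) :
    ofGroup α t c w * xLin α t c f = xLin α t c (dualAct w.1 f) * ofGroup α t c w := by
  have := mk_eq (Rel.g_x (α := α) (t := t) (c := c) w f)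
  rwa [map_mul, map_mul] at this

theorem Cherednik.g_mul_y (w : W) (v : h) :
    ofGroup α t c w * yLin α t c v = yLin α t c (w.1 v) * ofGroup α t c w := by
  have := mk_eq (Rel.g_y (α := α) (t := t) (c := c) w v)
  rwa [map_mul, map_mul] at this

theorem Cherednik.x_mul_x (f f' : Module.Dual ℂ h) :
    xLin α t c f * xLin α t c f' = xLin α t c f' * xLin α t c f := by
  have := mk_eq (Rel.x_comm (α := α) (t := t) (c := c) f f')
  rwa [map_mul, map_mul] at this

theorem Cherednik.y_mul_y (v v' : h) :
    yLin α t c v * yLin α t c v' = yLin α t c v' * yLin α t c v := by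
  have := mk_eq (Rel.y_comm (α := α) (t := t) (c := c) v v')
  rwa [map_mul, map_mul] at this

variable [Fintype W]

/-- The generators of the Cherednik algebra satisfy its relations. -/
def repX : (datumX α t c hc).Rep (Cherednik α t c) where
  x := Cherednik.xLin α t c
  y := Cherednik.yLin α t c
  g := Cherednik.ofGroup α t c
  g_x := Cherednik.g_mul_x α t c
  g_y := Cherednik.g_mul_y α t c
  x_comm := Cherednik.x_mul_x α t c
  y_comm := Cherednik.y_mul_y α t c
  y_x v f := by
    rw [← sub_eq_iff_eq_add', Cherednik.yLin_mul_xLin]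
    simp only [← formX_mul]
    rfl

/-- The generators of the Cherednik algebra satisfy its relations, with the roles of `h` and its
dual exchanged. -/
def repY : (datumY α t c hc).Rep (Cherednik α t c) where
  x := Cherednik.yLin α t c
  y := Cherednik.xLin α t c
  g := Cherednik.ofGroup α t c
  g_x := Cherednik.g_mul_y α t c
  g_y := Cherednik.g_mul_x α t c
  x_comm := Cherednik.y_mul_y α t c
  y_comm := Cherednik.x_mul_x α t c
  y_x f v := by
    rw [← sub_eq_iff_eq_add', ← neg_sub, Cherednik.yLin_mul_xLin, neg_add,
      ← Finset.sum_neg_distrib]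
    simp only [← neg_smul, ← formY_mul, ← neg_mul]
    rfl

theorem datumX_commutator {E : Type*} [Ring E] [Algebra ℂ E] (R : (datumX α t c hc).Rep E) (v : h)
    (f : Module.Dual ℂ h) :
    R.y v * R.x f - R.x f * R.y v = (t * f v) • 1 + ∑ s, commCoeff α c s v f • R.g s := by
  rw [R.y_x, add_sub_cancel_left]
  simp only [← formX_mul]
  rfl

theorem datumY_commutator {E : Type*} [Ring E] [Algebra ℂ E] (R : (datumY α t c hc).Rep E) (v : h)
    (f : Module.Dual ℂ h) :
    R.x v * R.y f - R.y f * R.x v = (t * f v) • 1 + ∑ s, commCoeff α c s v f • R.g s := by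
  have e (s) : commCoeff α c s v f = -((datumY α t c hc).θ s f * (datumY α t c hc).β s v) :=
    neg_eq_iff_eq_neg.1 (formY_mul α c s v f).symm
  have e' : t * f v = -((datumY α t c hc).pair f v) := (neg_eq_iff_eq_neg.2 (neg_mul _ _)).symm
  rw [← neg_sub, R.y_x, add_sub_cancel_left, neg_add, ← Finset.sum_neg_distrib]
  simp only [e, e', neg_smul]

variable {ι : Type*} [Fintype ι] (b : Module.Basis ι ℂ h)

include hc in
-- The Dunkl operators satisfy the defining relations, so the universal property supplies the action
-- required by `exists_pderiv`.
theorem exists_pderivX : ∃ d : ι → Module.End ℂ (Cherednik α t c),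
    (∀ i f a, d i (Cherednik.xLin α t c f * a) = f (b i) • a + Cherednik.xLin α t c f * d i a) ∧
    ∀ i, ∀ a ∈ Algebra.adjoin ℂ (Set.range (Cherednik.yLin α t c) ∪
      Set.range (Cherednik.ofGroup α t c)), d i a = 0 := by
  classical
  let R := (repX α t c hc).induced b.dualBasis
  obtain ⟨Ψ, hx, hy, hg⟩ := Cherednik.exists_lift α t c R.x R.y R.g R.g_x R.g_y R.x_comm
    R.y_comm (datumX_commutator α t c hc R)
  obtain ⟨d, hd, hd'⟩ := (repX α t c hc).exists_pderiv b.dualBasis Ψ hx hy hg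
    (Cherednik.adjoin_eq_top α t c)
  refine ⟨d, fun i f a => (hd i f a).trans ?_, hd'⟩
  rw [Module.Basis.coord_apply, Module.Basis.dualBasis_repr]
  rfl

include hc in
theorem exists_pderivY : ∃ d : ι → Module.End ℂ (Cherednik α t c),
    (∀ i v a, d i (Cherednik.yLin α t c v * a) =
      b.coord i v • a + Cherednik.yLin α t c v * d i a) ∧
    ∀ i, ∀ a ∈ Algebra.adjoin ℂ (Set.range (Cherednik.xLin α t c) ∪
      Set.range (Cherednik.ofGroup α t c)), d i a = 0 := by
  let R := (repY α t c hc).induced b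
  obtain ⟨Ψ, hx, hy, hg⟩ := Cherednik.exists_lift α t c R.y R.x R.g R.g_y R.g_x R.y_comm
    R.x_comm (datumY_commutator α t c hc R)
  exact (repY α t c hc).exists_pderiv b Ψ hy hx hg (by
    rw [← Cherednik.adjoin_eq_top α t c]
    congr 2
    exact Set.union_comm _ _)

/-! ### The Clifford algebra and the Pin cover as abstract data -/

variable (h) in
/-- `cliffX` as a linear map. -/
def cliffXLin : Module.Dual ℂ h →ₗ[ℂ] Cliff h :=
  CliffordAlgebra.ι (cliffordForm h) ∘ₗ LinearMap.inl ℂ _ _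

variable (h) in
/-- `cliffY` as a linear map. -/
def cliffYLin : h →ₗ[ℂ] Cliff h :=
  CliffordAlgebra.ι (cliffordForm h) ∘ₗ LinearMap.inr ℂ _ _

theorem cliff_mul_swap (p q : Module.Dual ℂ h × h) :
    CliffordAlgebra.ι (cliffordForm h) p * CliffordAlgebra.ι (cliffordForm h) q =
      -(CliffordAlgebra.ι (cliffordForm h) q * CliffordAlgebra.ι (cliffordForm h) p) -
        (2 * (p.1 q.2 + q.1 p.2)) • 1 := by
  have := CliffordAlgebra.ι_mul_ι_add_swap (Q := cliffordForm h) p q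
  rw [polar_cliffordForm, Algebra.algebraMap_eq_smul_one] at this
  rw [eq_sub_of_add_eq this, neg_mul, neg_smul]
  abel

theorem cliff_adjoin : Algebra.adjoin ℂ (Set.range (cliffXLin h) ∪ Set.range (cliffYLin h)) = ⊤ := by
  rw [← top_le_iff, ← CliffordAlgebra.adjoin_range_ι]
  refine Algebra.adjoin_le ?_
  rintro _ ⟨p, rfl⟩
  have : CliffordAlgebra.ι (cliffordForm h) p = cliffXLin h p.1 + cliffYLin h p.2 := by
    simp [cliffXLin, cliffYLin, ← map_add]
  rw [this]
  exact add_mem (Algebra.subset_adjoin (.inl ⟨_, rfl⟩)) (Algebra.subset_adjoin (.inr ⟨_, rfl⟩))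

theorem cliffCstar_cliffX (z : ℂˣ) (f : Module.Dual ℂ h) :
    cliffCstar z (cliffXLin h f) = (↑z⁻¹ : ℂ) • cliffXLin h f := by
  rw [← map_smul]
  refine (CliffordAlgebra.map_apply_ι _ _).trans (congrArg _ (Prod.ext rfl ?_))
  exact smul_zero _

theorem cliffCstar_cliffY (z : ℂˣ) (v : h) :
    cliffCstar z (cliffYLin h v) = (z : ℂ) • cliffYLin h v := by
  rw [← map_smul]
  refine (CliffordAlgebra.map_apply_ι _ _).trans (congrArg _ (Prod.ext ?_ rfl))
  exact smul_zero _

variable (W) in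
/-- The map from the double cover to the Clifford algebra. -/
def pinCoverToCliff : pinCover W →* Cliff h where
  toFun q := q.1.1
  map_one' := rfl
  map_mul' _ _ := rfl

variable (W) in
/-- The covering map. -/
def pinCoverProj : pinCover W →* W := (MonoidHom.snd _ _).comp (pinCover W).subtype

variable (hW : Subgroup.closure (pseudoReflections W) = ⊤)

include α hW in
theorem pinCover_mul_cliffX (q : pinCover W) (f : Module.Dual ℂ h) :
    pinCoverToCliff W q * cliffXLin h f =
      cliffXLin h (dualActLin W (pinCoverProj W q) f) * pinCoverToCliff W q := by
  refine (mul_ι_of_mem_pinCover α hW q.2 _).trans (congrArg (· * _) (congrArg _ (Prod.ext rfl ?_)))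
  exact map_zero _

include α hW in
theorem pinCover_mul_cliffY (q : pinCover W) (v : h) :
    pinCoverToCliff W q * cliffYLin h v =
      cliffYLin h (actLin W (pinCoverProj W q) v) * pinCoverToCliff W q := by
  refine (mul_ι_of_mem_pinCover α hW q.2 _).trans (congrArg (· * _) (congrArg _ (Prod.ext ?_ rfl)))
  exact map_zero (dualActLin W q.1.2)

include α hW in
theorem pinCoverProj_surjective : Function.Surjective (pinCoverProj W) := by
  intro w
  obtain ⟨u, hu, -⟩ := exists_lift α hW w
  exact ⟨⟨_, hu⟩, rfl⟩

theorem sum_coord (f : Module.Dual ℂ h) : ∑ i, f (b i) • b.coord i = f :=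
  b.ext fun j => by classical simp

/-- The datum of the half-Dirac operator `D_x`. -/
def diracDatumX {d : ι → Module.End ℂ (Cherednik α t c)}
    (hd : ∀ i f a, d i (Cherednik.xLin α t c f * a) =
      f (b i) • a + Cherednik.xLin α t c f * d i a)
    (hd' : ∀ i, ∀ a ∈ Algebra.adjoin ℂ (Set.range (Cherednik.yLin α t c) ∪
      Set.range (Cherednik.ofGroup α t c)), d i a = 0) :
    DiracDatum (repX α t c hc) (Cliff h) (pinCover W) ι where
  cX := cliffXLin h
  cY := cliffYLin h
  P := LinearMap.id
  b := b.coord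
  b' := b
  expand_x := sum_coord b
  expand_y := b.sum_repr
  P_act w f v := dualAct_apply_apply w.1 f v
  cX_anti f f' := by simp [cliffXLin, cliff_mul_swap (f, 0)]
  cY_anti v v' := by simp [cliffYLin, cliff_mul_swap (0, v)]
  cY_cX v f := by simp [cliffXLin, cliffYLin, cliff_mul_swap (0, v)]
  parity := CliffordAlgebra.involute
  parity_cX f := CliffordAlgebra.involute_ι _
  parity_cY v := CliffordAlgebra.involute_ι _
  adjoin_C := cliff_adjoin
  adjoin_H := Cherednik.adjoin_eq_top α t c
  u := pinCoverToCliff W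
  π := pinCoverProj W
  π_surjective := pinCoverProj_surjective α hW
  u_cX := pinCover_mul_cliffX α hW
  u_cY := pinCover_mul_cliffY α hW
  parity_u q := (evenInv_of_mem_pinCover α hW q.2).1
  ker_comm := pinCover_ker_comm α hW
  d := d
  d_x_mul := hd
  d_eq_zero := hd'
  σH := Cherednik.cstar α t c
  σC := cliffCstar
  σH_x z f := Cherednik.cstar_gen α t c z (.x f)
  σH_y z v := Cherednik.cstar_gen α t c z (.y v)
  σH_g z w := Cherednik.cstar_gen α t c z (.g w)
  σC_cX := cliffCstar_cliffX
  σC_cY := cliffCstar_cliffY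
  σC_u z q := (evenInv_of_mem_pinCover α hW q.2).2 z

/-- The datum of the half-Dirac operator `D_y`. -/
def diracDatumY {d : ι → Module.End ℂ (Cherednik α t c)}
    (hd : ∀ i v a, d i (Cherednik.yLin α t c v * a) =
      b.coord i v • a + Cherednik.yLin α t c v * d i a)
    (hd' : ∀ i, ∀ a ∈ Algebra.adjoin ℂ (Set.range (Cherednik.xLin α t c) ∪
      Set.range (Cherednik.ofGroup α t c)), d i a = 0) :
    DiracDatum (repY α t c hc) (Cliff h) (pinCover W) ι where
  cX := cliffYLin h
  cY := cliffXLin h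
  P := Module.Dual.eval ℂ h
  b := b
  b' := b.coord
  expand_x := b.sum_repr
  expand_y := sum_coord b
  P_act w v f := dualAct_apply_apply w.1 f v
  cX_anti v v' := by simp [cliffYLin, cliff_mul_swap (0, v)]
  cY_anti f f' := by simp [cliffXLin, cliff_mul_swap (f, 0)]
  cY_cX f v := by simp [cliffXLin, cliffYLin, cliff_mul_swap (f, 0)]
  parity := CliffordAlgebra.involute
  parity_cX v := CliffordAlgebra.involute_ι _
  parity_cY f := CliffordAlgebra.involute_ι _
  adjoin_C := by rw [Set.union_comm]; exact cliff_adjoin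
  adjoin_H := by
    rw [← Cherednik.adjoin_eq_top α t c]
    congr 2
    exact Set.union_comm _ _
  u := pinCoverToCliff W
  π := pinCoverProj W
  π_surjective := pinCoverProj_surjective α hW
  u_cX := pinCover_mul_cliffY α hW
  u_cY := pinCover_mul_cliffX α hW
  parity_u q := (evenInv_of_mem_pinCover α hW q.2).1
  ker_comm := pinCover_ker_comm α hW
  d := d
  d_x_mul := hd
  d_eq_zero := hd'
  -- With the roles exchanged, `h` must carry weight `-1`, hence the inverse. The invariants are
  -- unchanged.
  σH z := Cherednik.cstar α t c z⁻¹
  σC z := cliffCstar z⁻¹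
  σH_x z v := Cherednik.cstar_gen α t c z⁻¹ (.y v)
  σH_y z f := (Cherednik.cstar_gen α t c z⁻¹ (.x f)).trans (by rw [Cherednik.cstarGen, inv_inv]; rfl)
  σH_g z w := Cherednik.cstar_gen α t c z⁻¹ (.g w)
  σC_cX z v := cliffCstar_cliffY z⁻¹ v
  σC_cY z f := (cliffCstar_cliffX z⁻¹ f).trans (by rw [inv_inv])
  σC_u z q := (evenInv_of_mem_pinCover α hW q.2).2 z⁻¹

end

/-! ### From the abstract data to the theorem -/

section

variable {h : Type*} [AddCommGroup h] [Module ℂ h] {W : Subgroup (h ≃ₗ[ℂ] h)} [Fintype W]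
  {α : RootChoice W} {t : ℂ} {c : W → ℂ} {X Y ι : Type*} [AddCommGroup X] [Module ℂ X]
  [AddCommGroup Y] [Module ℂ Y] [Fintype ι] {D : DunklDatum W X Y} {R : D.Rep (Cherednik α t c)}

/-- The hypothesis `hσ` compares only fixed elements, not the actions, because the action attached
to `D_y` is the inverse one. -/
theorem ker_eq_of_datum (K : DiracDatum R (Cliff h) (pinCover W) ι)
    (hε : K.ε = parity α t c) (hΔ : K.Δ = diagGroup α t c)
    (hσ : ∀ a, (∀ z, K.σ z a = a) ↔ a ∈ algA α t c) :
    (∀ a ∈ algAInv α t c, oddDer K.dirac a ∈ algAInv α t c) ∧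
      Subalgebra.toSubmodule (algAInv α t c) ⊓ LinearMap.ker (oddDer K.dirac) =
        (Subalgebra.toSubmodule (algAInv α t c)).map (oddDer K.dirac) ⊔ diagInv α t c ∧
      Disjoint ((Subalgebra.toSubmodule (algAInv α t c)).map (oddDer K.dirac))
        (diagInv α t c) := by
  have hδ : oddDer K.dirac = K.δ := by rw [oddDer, DiracDatum.δ, hε]
  have hinv (a) : a ∈ algAInv α t c ↔ K.Inv a := by
    refine and_congr (hσ a).symm (forall_congr' fun q => ?_)
    rw [K.conj_apply, hΔ]
  have hlin (z) : diag α t c z = K.Δlin z := by rw [diag, DiracDatum.Δlin, hΔ]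
  have hz (z) : z ∈ groupAlgInv W ↔ ∀ q, K.conjAlg q z = z :=
    forall_congr' fun q => by rw [K.conjAlg_apply]
  rw [hδ]
  refine ⟨fun a ha => (hinv _).2 ((hinv a).1 ha).δ, le_antisymm ?_ (sup_le ?_ ?_), ?_⟩
  · rintro a ⟨ha, ha'⟩
    obtain ⟨a', h1, z, h2, rfl⟩ := K.exists_eq_δ_add_of_inv ((hinv a).1 ha) ha'
    exact Submodule.add_mem_sup ⟨a', (hinv a').2 h1, rfl⟩ ⟨z, (hz z).2 h2, hlin z⟩
  · rintro _ ⟨a, ha, rfl⟩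
    exact ⟨(hinv _).2 ((hinv a).1 ha).δ, K.δ_δ a⟩
  · rintro _ ⟨z, h1, rfl⟩
    change diag α t c z ∈ _
    rw [hlin]
    exact ⟨(hinv _).2 (K.inv_Δlin ((hz z).1 h1)), K.δ_Δlin z⟩
  · rw [Submodule.disjoint_def]
    rintro _ ⟨a, ha, rfl⟩ ⟨z, -, h2⟩
    exact K.δ_eq_zero ((hinv a).1 ha).1 (h2.symm.trans (hlin z))

end

end HalfDirac

end

theorem mainTheorem2 {h : Type*} [AddCommGroup h] [Module ℂ h] [FiniteDimensional ℂ h]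
    (W : Subgroup (h ≃ₗ[ℂ] h)) [Finite W]
    (hW : Subgroup.closure (HalfDirac.pseudoReflections W) = ⊤)
    (α : HalfDirac.RootChoice W) (t : ℂ) (c : W → ℂ)
    (hc : ∀ w : W, ∀ s ∈ HalfDirac.pseudoReflections W, c (w * s * w⁻¹) = c s)
    {ι : Type*} [Fintype ι] (b : Module.Basis ι ℂ h) :
    ∀ D : HalfDirac.HC α t c,
      D = HalfDirac.diracX α t c b ∨ D = HalfDirac.diracY α t c b →
        (∀ a ∈ HalfDirac.algAInv α t c, HalfDirac.oddDer D a ∈ HalfDirac.algAInv α t c) ∧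
        Subalgebra.toSubmodule (HalfDirac.algAInv α t c) ⊓ LinearMap.ker (HalfDirac.oddDer D) =
          (Subalgebra.toSubmodule (HalfDirac.algAInv α t c)).map (HalfDirac.oddDer D) ⊔
            HalfDirac.diagInv α t c ∧
        Disjoint ((Subalgebra.toSubmodule (HalfDirac.algAInv α t c)).map (HalfDirac.oddDer D))
          (HalfDirac.diagInv α t c) := by
  have := Fintype.ofFinite W
  have hA (a) : a ∈ HalfDirac.algA α t c ↔ ∀ z, HalfDirac.cstar α t c z a = a := by
    simp [HalfDirac.algA, Algebra.mem_iInf, AlgHom.mem_equalizer]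
  rintro _ (rfl | rfl)
  · obtain ⟨d, hd, hd'⟩ := HalfDirac.exists_pderivX α t c hc b
    exact HalfDirac.ker_eq_of_datum (HalfDirac.diracDatumX α t c hc b hW hd hd') rfl rfl
      fun a => (hA a).symm
  · obtain ⟨d, hd, hd'⟩ := HalfDirac.exists_pderivY α t c hc b
    exact HalfDirac.ker_eq_of_datum (HalfDirac.diracDatumY α t c hc b hW hd hd') rfl rfl
      fun a => ⟨fun h' => (hA a).2 fun z => by simpa using! h' z⁻¹, fun h' z => (hA a).1 h' z⁻¹⟩
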